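/- **Setting.** Let $\nu$ be a mean-zero probability law on $\mathbb R$ with distribution function $F$ and density $f=F'$, such that $F$ is strictly increasing on $\mathbb R$, $F$ and $1-F$ are log-concave, and $f,f',f''$ exist and are bounded on every bounded interval. Put $\phi(v)=v-\frac{1-F(v)}{f(v)}$ and $g(v)=v+\phi^{-1}(-v)$. Let $B,W_x,W_\theta,\lambda>0$ and $\Theta=\{\theta\in\mathbb R^{d+1}:\|\theta\|_1\le W_\theta\}$, $d\ge 1$. The buyer of period $t$ has the feature $\tilde x_t^0\in\mathbb R^d$; for a vector $\tilde x\in\mathbb R^d$ write $x=(\tilde x^\top,1)^\top$. The $\tilde x_t^0$ are i.i.d. with a law $\mathbb P_X$, the noises $z_t$ are i.i.d. with law $\nu$ and independent of them, the valuation is $v_t=\theta_0^\top x_t^0+z_t$ with $\theta_0=(\beta_0^\top,\alpha_0)^\top\in\Theta$, and a price $p$ is accepted if and only if $p\le v_t$. Let $Q$ be the set of laws $\mathbb P_X$ with $\|x_t^0\|_2\le W_x$ almost surely for which $\Sigma=\mathbb E[x_t^0x_t^{0\top}]$ is positive definite with smallest eigenvalue at least $\lambda$. Let $A$ be a known symmetric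 positive definite $d\times d$ matrix with smallest eigenvalue $\lambda_{A\min}$. **Policy.** The inputs are $B$, an integer $\ell_0\ge1$ and $C_a>0$. Episode $k=1,2,\dots$ consists of the periods $t=\ell_k,\dots,\ell_{k+1}-1$, where $\ell_k=2^{k-1}\ell_0$; put $a_k=\lfloor\sqrt{C_a\ell_k}\rfloor$. In the periods $t<\ell_k+a_k$ of the episode (exploration) the buyer reveals $\tilde x_t^0$ and the price $p_t\sim\mathrm{Unif}(0,B)$ is drawn independently of everything else. Let $\hat\theta_k=(\hat\beta_k^\top,\hat\alpha_k)^\top$ be a maximum likelihood estimate over $\Theta$, i.e. a (measurably chosen) maximizer of $$\frac1{a_k}\sum_{t=\ell_k}^{\ell_k+a_k-1}\Big\{\mathbb I(p_t\le v_t)\log\big[1-F(p_t-\theta^\top x_t^0)\big]+\mathbb I(p_t>v_t)\log F(p_t-\theta^\top x_t^0)\Big\}.$$ In the remaining periods of the episode (exploitation) the buyer reveals a manipulated feature $\tilde x_t$, a measurable function of $\tilde x_t^0$ with $$\tilde x_t=\tilde x_t^0-A^{-1}\beta_0\,g'(\alpha_0+\beta_0^\top\tilde x_t),$$ the first-order condition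 for minimizing $g(\alpha_0+\beta_0^\top\tilde x)+\frac12(\tilde x-\tilde x_t^0)^\top A(\tilde x-\tilde x_t^0)$ over $\tilde x$, and the price is $$p_t=g\big(\hat\theta_k^\top x_t+\hat\beta_k^\top A^{-1}\hat\beta_k\,g'(\hat\theta_k^\top x_t)\big).$$ With the clairvoyant price $p_t^*=g(\theta_0^\top x_t^0)$, and since the policy starts in the period labelled $\ell_0$, the worst-case expected regret up to period $T$ is $$\mathrm{Regret}(T)=\sup_{\theta_0\in\Theta,\ \mathbb P_X\in Q}\mathbb E\sum_{t=\ell_0}^{T}\big[p_t^*\,\mathbb I(v_t\ge p_t^*)-p_t\,\mathbb I(v_t\ge p_t)\big].$$ **Theorem.** Let the exploration parameter be of the order $d+1$ in the sense that $$\kappa_1(d+1)\le C_a\le\Big(\kappa_2+\frac{\kappa_3}{\lambda_{A\min}^2}\Big)(d+1)$$ for constants $\kappa_1>0$, $\kappa_2$, $\kappa_3$. There is a constant $C_1^*>0$, depending only on $\nu,B,W_x,W_\theta,\lambda,\kappa_1,\kappa_2$, and for every $\underline\lambda>0$ there is a constant $C_2^*>0$, depending in addition only on $\underline\lambda$ and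 $\kappa_3$, such that for all $d\ge1$, all $A$ with $\lambda_{A\min}\ge\underline\lambda$, all such $C_a$, all $\ell_0\ge1$, all $T\ge 0$, and all maximum likelihood estimates and buyer responses as above, the expectations in the regret exist and $$\mathrm{Regret}(T)\le\sqrt{C_1^*+\frac{C_2^*}{\lambda_{A\min}^2}}\;\sqrt{(d+1)T}.$$ -/

import Mathlib

open MeasureTheory ProbabilityTheory Set Matrix

noncomputable section

namespace StrategicPricing

/-! ### Noise distribution and pricing function -/

/-- Distribution function `F` of the noise. -/
def noiseCDF (ν : Measure ℝ) (v : ℝ) : ℝ := cdf ν v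

/-- Density `f = F'` of the noise. -/
def noisePDF (ν : Measure ℝ) : ℝ → ℝ := deriv (noiseCDF ν)

/-- The noise has mean zero, `F` is strictly increasing, `F` and `1 - F` are log-concave, and
`f`, `f'`, `f''` exist and are bounded on every bounded interval. -/
structure NoiseAssumption (ν : Measure ℝ) : Prop where
  isProbabilityMeasure : IsProbabilityMeasure ν
  integrable : Integrable (fun z : ℝ => z) ν
  mean_zero : ∫ z, z ∂ν = 0
  strictMono : StrictMono (noiseCDF ν)
  logConcave_cdf : ConcaveOn ℝ univ (fun v => Real.log (noiseCDF ν v))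
  logConcave_tail : ConcaveOn ℝ univ (fun v => Real.log (1 - noiseCDF ν v))
  differentiable_cdf : Differentiable ℝ (noiseCDF ν)
  differentiable_pdf : Differentiable ℝ (noisePDF ν)
  differentiable_deriv_pdf : Differentiable ℝ (deriv (noisePDF ν))
  locally_bounded : ∀ R : ℝ, ∃ M₀ M₁ M₂ : ℝ, ∀ v ∈ Icc (-R) R,
    |noisePDF ν v| < M₀ ∧ |deriv (noisePDF ν) v| < M₁ ∧ |deriv (deriv (noisePDF ν)) v| < M₂

/-- Virtual valuation function `φ(v) = v - (1 - F(v)) / f(v)`. -/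
def virtualValuation (ν : Measure ℝ) (v : ℝ) : ℝ := v - (1 - noiseCDF ν v) / noisePDF ν v

/-- Pricing function `g(v) = v + φ⁻¹(-v)`. -/
def pricing (ν : Measure ℝ) (v : ℝ) : ℝ := v + Function.invFun (virtualValuation ν) (-v)

/-! ### Features, parameters, eigenvalues -/

/-- The extended feature vector `x = (x̃, 1)`. -/
def augment {d : ℕ} (x : Fin d → ℝ) : Fin (d + 1) → ℝ := Fin.snoc x 1

/-- The slope part `β` of a parameter `θ = (β, α)`. -/
def slopePart {d : ℕ} (θ : Fin (d + 1) → ℝ) : Fin d → ℝ := fun i => θ i.castSucc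

/-- The parameter set `Θ = {θ : ‖θ‖₁ ≤ Wθ}`. -/
def paramSet (d : ℕ) (Wθ : ℝ) : Set (Fin (d + 1) → ℝ) := {θ | ∑ i, |θ i| ≤ Wθ}

/-- The smallest eigenvalue of a real symmetric matrix of positive size. -/
def minEigenvalue {n : ℕ} (M : Matrix (Fin n) (Fin n) ℝ) : ℝ := sInf (spectrum ℝ M)

/-- The matrix `Σ = E[x xᵀ]` of the extended feature vector, for features with law `P`. -/
def secondMoment {d : ℕ} (P : Measure (Fin d → ℝ)) : Matrix (Fin (d + 1)) (Fin (d + 1)) ℝ :=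
  fun i j => ∫ x, augment x i * augment x j ∂P

/-- The admissible feature distributions: `‖(x̃, 1)‖₂ ≤ Wx` almost surely, and `Σ` is positive
definite with smallest eigenvalue at least `lam`. -/
def featureLaws (d : ℕ) (Wx lam : ℝ) : Set (Measure (Fin d → ℝ)) :=
  {P | IsProbabilityMeasure P ∧ (∀ᵐ x ∂P, ‖WithLp.toLp 2 (augment x)‖ ≤ Wx) ∧
    (secondMoment P).PosDef ∧ lam ≤ minEigenvalue (secondMoment P)}

/-! ### The random input of the pricing problem -/

/-- What chance draws in one period: the true feature `x̃⁰` of the buyer, the noise `z` in the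
valuation, and a price drawn from the uniform distribution (used only in exploration periods). -/
abbrev Draw (d : ℕ) : Type := (Fin d → ℝ) × ℝ × ℝ

/-- The true feature in a draw. -/
abbrev Draw.feature {d : ℕ} (w : Draw d) : Fin d → ℝ := w.1

/-- The noise in a draw. -/
abbrev Draw.noise {d : ℕ} (w : Draw d) : ℝ := w.2.1

/-- The uniform price in a draw. -/
abbrev Draw.uniformPrice {d : ℕ} (w : Draw d) : ℝ := w.2.2

/-- Law of one draw: feature `∼ P`, noise `∼ ν`, price `∼ Unif(0, B)`, independent. -/
def drawLaw {d : ℕ} (ν : Measure ℝ) (B : ℝ) (P : Measure (Fin d → ℝ)) : Measure (Draw d) :=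
  P.prod (ν.prod (volume[|Ioo 0 B]))

/-- Law of the whole sequence of draws: independent over periods and identically distributed. -/
def sampleLaw {d : ℕ} (ν : Measure ℝ) (B : ℝ) (P : Measure (Fin d → ℝ)) :
    Measure (ℕ → Draw d) :=
  Measure.infinitePi fun _ => drawLaw ν B P

/-- Valuation `v_t = θ₀ᵀ x_t⁰ + z_t`. -/
def valuation {d : ℕ} (θ₀ : Fin (d + 1) → ℝ) (ω : ℕ → Draw d) (t : ℕ) : ℝ :=
  θ₀ ⬝ᵥ augment (ω t).feature + (ω t).noise

/-! ### Maximum likelihood estimation -/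

/-- One exploration record `(p_t, x̃_t, y_t)`; `y_t = true` means that a sale occurred. -/
abbrev Record (d : ℕ) : Type := ℝ × (Fin d → ℝ) × Bool

/-- Average log-likelihood of `θ` for the noise distribution `ν`. -/
def logLikelihood {d : ℕ} (ν : Measure ℝ) (n : ℕ) (D : Fin n → Record d)
    (θ : Fin (d + 1) → ℝ) : ℝ :=
  1 / (n : ℝ) * ∑ j, if (D j).2.2 = true
    then Real.log (1 - noiseCDF ν ((D j).1 - θ ⬝ᵥ augment (D j).2.1))
    else Real.log (noiseCDF ν ((D j).1 - θ ⬝ᵥ augment (D j).2.1))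

/-- A rule that turns a sample of any size `n` into a parameter estimate. -/
abbrev Estimator (d : ℕ) : Type := (n : ℕ) → (Fin n → Record d) → (Fin (d + 1) → ℝ)

/-- `est` is a (measurable) maximum likelihood estimator over `Θ`. -/
def IsMLE {d : ℕ} (ν : Measure ℝ) (Wθ : ℝ) (est : Estimator d) : Prop :=
  ∀ n, Measurable (est n) ∧ ∀ D : Fin n → Record d,
    est n D ∈ paramSet d Wθ ∧ IsMaxOn (logLikelihood ν n D) (paramSet d Wθ) (est n D)

/-! ### Strategic buyers -/

/-- How buyers respond to the optimal pricing policy: for the true parameter `θ₀`, the buyer of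
period `t` with true feature `x̃⁰` reveals `resp θ₀ t x̃⁰`. -/
abbrev Response (d : ℕ) : Type := (Fin (d + 1) → ℝ) → ℕ → (Fin d → ℝ) → (Fin d → ℝ)

/-- The revealed feature depends measurably on the true one and satisfies
`x̃ = x̃⁰ - A⁻¹ β₀ g'(α₀ + β₀ᵀ x̃)`, the first-order condition for a minimum of the total cost
`g(α₀ + β₀ᵀ x̃) + (x̃ - x̃⁰)ᵀ A (x̃ - x̃⁰) / 2`. -/
def IsManipulation {d : ℕ} (ν : Measure ℝ) (A : Matrix (Fin d) (Fin d) ℝ)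
    (resp : Response d) : Prop :=
  ∀ θ₀ t, Measurable (resp θ₀ t) ∧ ∀ x₀, resp θ₀ t x₀ =
    x₀ - deriv (pricing ν) (θ₀ ⬝ᵥ augment (resp θ₀ t x₀)) • (A⁻¹ *ᵥ slopePart θ₀)

/-! ### The pricing policy -/

/-- Length `ℓ_k = 2^(k-1) ℓ₀` of episode `k = 1, 2, …`, and also its first period. -/
def episodeLength (ℓ₀ k : ℕ) : ℕ := 2 ^ (k - 1) * ℓ₀

/-- Length `a_k = ⌊√(C_a ℓ_k)⌋` of the exploration phase of episode `k`. -/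
def exploreLength (Ca : ℝ) (ℓ₀ k : ℕ) : ℕ := ⌊Real.sqrt (Ca * episodeLength ℓ₀ k)⌋₊

/-- The episode `k` with `ℓ_k ≤ t < ℓ_{k+1}` (for `t ≥ ℓ₀ ≥ 1`). -/
def episodeOf (ℓ₀ t : ℕ) : ℕ := Nat.log 2 (t / ℓ₀) + 1

/-- Record of an exploration period: the uniform price is posted and the true feature is
revealed; a sale occurs if the price is at most the valuation. -/
def exploreRecord {d : ℕ} (θ₀ : Fin (d + 1) → ℝ) (ω : ℕ → Draw d) (t : ℕ) : Record d :=
  ((ω t).uniformPrice, (ω t).feature, decide ((ω t).uniformPrice ≤ valuation θ₀ ω t))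

/-- Estimate `θ̂_k` from the exploration periods `ℓ_k, …, ℓ_k + a_k - 1` of episode `k`. -/
def estimate {d : ℕ} (Ca : ℝ) (ℓ₀ : ℕ) (est : Estimator d) (θ₀ : Fin (d + 1) → ℝ)
    (ω : ℕ → Draw d) (k : ℕ) : Fin (d + 1) → ℝ :=
  est (exploreLength Ca ℓ₀ k) fun j => exploreRecord θ₀ ω (episodeLength ℓ₀ k + j)

/-- Exploitation price `g(θ̂ᵀ x + β̂ᵀ A⁻¹ β̂ g'(θ̂ᵀ x))` for a revealed feature `x̃`. -/
def exploitPrice {d : ℕ} (ν : Measure ℝ) (A : Matrix (Fin d) (Fin d) ℝ)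
    (θ : Fin (d + 1) → ℝ) (x : Fin d → ℝ) : ℝ :=
  pricing ν (θ ⬝ᵥ augment x +
    (slopePart θ ⬝ᵥ A⁻¹ *ᵥ slopePart θ) * deriv (pricing ν) (θ ⬝ᵥ augment x))

/-- Price `p_t` posted by the episodic explore-then-commit policy in period `t ≥ ℓ₀`. -/
def postedPrice {d : ℕ} (ν : Measure ℝ) (A : Matrix (Fin d) (Fin d) ℝ) (Ca : ℝ) (ℓ₀ : ℕ)
    (est : Estimator d) (resp : Response d) (θ₀ : Fin (d + 1) → ℝ) (ω : ℕ → Draw d)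
    (t : ℕ) : ℝ :=
  let k := episodeOf ℓ₀ t
  if t < episodeLength ℓ₀ k + exploreLength Ca ℓ₀ k then (ω t).uniformPrice
  else exploitPrice ν A (estimate Ca ℓ₀ est θ₀ ω k) (resp θ₀ t (ω t).feature)

/-- Price `p_t* = g(θ₀ᵀ x_t⁰)` of the clairvoyant seller. -/
def oraclePrice {d : ℕ} (ν : Measure ℝ) (θ₀ : Fin (d + 1) → ℝ) (ω : ℕ → Draw d) (t : ℕ) : ℝ :=
  pricing ν (θ₀ ⬝ᵥ augment (ω t).feature)

/-! ### Regret -/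

/-- Revenue from posting the price `p` to a buyer with valuation `v`. -/
def revenue (p v : ℝ) : ℝ := if p ≤ v then p else 0

/-- Realized regret over the periods `ℓ₀, …, T`; the policy starts in the period labelled
`ℓ_1 = ℓ₀`. -/
def realizedRegret {d : ℕ} (ν : Measure ℝ) (A : Matrix (Fin d) (Fin d) ℝ) (Ca : ℝ) (ℓ₀ : ℕ)
    (est : Estimator d) (resp : Response d) (θ₀ : Fin (d + 1) → ℝ) (T : ℕ)
    (ω : ℕ → Draw d) : ℝ :=
  ∑ t ∈ Finset.Icc ℓ₀ T,
    (revenue (oraclePrice ν θ₀ ω t) (valuation θ₀ ω t) -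
      revenue (postedPrice ν A Ca ℓ₀ est resp θ₀ ω t) (valuation θ₀ ω t))

/-- Worst-case expected regret, over `θ₀ ∈ Θ` and over the admissible feature distributions. -/
def worstCaseRegret {d : ℕ} (ν : Measure ℝ) (B Wx Wθ lam : ℝ) (A : Matrix (Fin d) (Fin d) ℝ)
    (Ca : ℝ) (ℓ₀ : ℕ) (est : Estimator d) (resp : Response d) (T : ℕ) : EReal :=
  ⨆ θ₀ ∈ paramSet d Wθ, ⨆ P ∈ featureLaws d Wx lam,
    ((∫ ω, realizedRegret ν A Ca ℓ₀ est resp θ₀ T ω ∂(sampleLaw ν B P) : ℝ) : EReal)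

end StrategicPricing

end

namespace StrategicPricing

/-! ### Locally bounded functions and elementary calculus -/

/-- A real function that is bounded on every bounded interval. -/
def LocallyBounded (h : ℝ → ℝ) : Prop := ∀ R : ℝ, ∃ M : ℝ, 0 < M ∧ ∀ v, |v| ≤ R → |h v| ≤ M

lemma LocallyBounded.of_continuous {h : ℝ → ℝ} (hc : Continuous h) : LocallyBounded h := by
  intro R
  obtain ⟨C, hC⟩ := (isCompact_Icc (a := -R) (b := R)).exists_bound_of_continuousOn hc.continuousOn
  refine ⟨|C| + 1, by positivity, fun v hv => ?_⟩
  have := hC v (abs_le.mp hv)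
  rw [Real.norm_eq_abs] at this
  linarith [le_abs_self C]

lemma LocallyBounded.add {h k : ℝ → ℝ} (hh : LocallyBounded h) (hk : LocallyBounded k) :
    LocallyBounded (fun v => h v + k v) := by
  intro R
  obtain ⟨M, hM, h1⟩ := hh R
  obtain ⟨N, hN, h2⟩ := hk R
  exact ⟨M + N, by positivity, fun v hv => (abs_add_le _ _).trans (add_le_add (h1 v hv) (h2 v hv))⟩

lemma LocallyBounded.mul {h k : ℝ → ℝ} (hh : LocallyBounded h) (hk : LocallyBounded k) :
    LocallyBounded (fun v => h v * k v) := by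
  intro R
  obtain ⟨M, hM, h1⟩ := hh R
  obtain ⟨N, hN, h2⟩ := hk R
  refine ⟨M * N, by positivity, fun v hv => ?_⟩
  rw [abs_mul]
  exact mul_le_mul (h1 v hv) (h2 v hv) (abs_nonneg _) hM.le

/-- Mean value inequality on a symmetric interval. -/
lemma abs_sub_le_of_hasDerivAt {h h' : ℝ → ℝ} {R K : ℝ} (hd : ∀ v, |v| ≤ R → HasDerivAt h (h' v) v)
    (hb : ∀ v, |v| ≤ R → |h' v| ≤ K) {a b : ℝ} (ha : |a| ≤ R) (hb' : |b| ≤ R) :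
    |h a - h b| ≤ K * |a - b| := by
  have := (convex_Icc (-R) R).norm_image_sub_le_of_norm_hasDerivWithin_le (f := h) (f' := h')
    (C := K) (x := b) (y := a)
    (fun x hx => (hd x (abs_le.mpr hx)).hasDerivWithinAt)
    (fun x hx => by simpa using hb x (abs_le.mpr hx)) (abs_le.mp hb') (abs_le.mp ha)
  simpa using this

/-- Second order Taylor expansion with a crude cubic remainder. -/
lemma taylor_two_remainder {h h1 h2 h3 : ℝ → ℝ} (d1 : ∀ v, HasDerivAt h (h1 v) v)
    (d2 : ∀ v, HasDerivAt h1 (h2 v) v) (d3 : ∀ v, HasDerivAt h2 (h3 v) v) {R M : ℝ}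
    (hM : ∀ v, |v| ≤ R + 1 → |h3 v| ≤ M) {u t : ℝ} (hu : |u| ≤ R) (ht : |t| ≤ 1) :
    |h (u - t) - (h u - h1 u * t + h2 u * t ^ 2 / 2)| ≤ M * |t| ^ 3 := by
  have key : ∀ {e e' : ℝ → ℝ} {K : ℝ}, e 0 = 0 → (∀ s, HasDerivAt e (e' s) s) →
      (∀ s, |s| ≤ |t| → |e' s| ≤ K) → ∀ s, |s| ≤ |t| → |e s| ≤ K * |t| := by
    intro e e' K h0 hd hb s hs
    have h00 : |(0 : ℝ)| ≤ |t| := by simp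
    have := abs_sub_le_of_hasDerivAt (fun v _ => hd v) hb hs h00
    rw [h0, sub_zero, sub_zero] at this
    exact this.trans (mul_le_mul_of_nonneg_left hs ((abs_nonneg _).trans (hb 0 h00)))
  have sub : ∀ s : ℝ, HasDerivAt (fun s => u - s) (-1) s := fun s => by
    simpa using (hasDerivAt_id s).const_sub u
  have c1 : ∀ s, |s| ≤ |t| → |h2 (u - s) - h2 u| ≤ M * |t| := by
    refine key (e := fun s => h2 (u - s) - h2 u) (e' := fun s => h3 (u - s) * (-1)) (by simp)
      (fun s => ((d3 (u - s)).comp s (sub s)).sub_const _) fun s hs => ?_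
    rw [mul_neg_one, abs_neg]
    exact hM _ ((abs_sub _ _).trans (by linarith))
  have c2 : ∀ s, |s| ≤ |t| → |-h1 (u - s) + h1 u - h2 u * s| ≤ M * |t| * |t| := by
    refine key (e := fun s => -h1 (u - s) + h1 u - h2 u * s)
      (e' := fun s => h2 (u - s) - h2 u) (by simp) (fun s => ?_) c1
    have := ((((d2 (u - s)).comp s (sub s)).neg).add_const (h1 u)).sub
      ((hasDerivAt_id s).const_mul (h2 u))
    refine this.congr_deriv ?_
    ring
  have c3 : ∀ s, |s| ≤ |t| →
      |h (u - s) - (h u - h1 u * s + h2 u * s ^ 2 / 2)| ≤ M * |t| * |t| * |t| := by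
    refine key (e := fun s => h (u - s) - (h u - h1 u * s + h2 u * s ^ 2 / 2))
      (e' := fun s => -h1 (u - s) + h1 u - h2 u * s) (by simp) (fun s => ?_) c2
    have := ((d1 (u - s)).comp s (sub s)).sub (((hasDerivAt_const s (h u)).sub
      ((hasDerivAt_id s).const_mul (h1 u))).add
        ((((hasDerivAt_id s).pow 2).const_mul (h2 u)).div_const 2))
    refine this.congr_deriv ?_
    simp
    ring
  exact (c3 t le_rfl).trans (le_of_eq (by ring))

/-! ### The noise distribution -/

namespace NoiseAssumption

variable {ν : Measure ℝ}

lemma cdf_pos (hν : NoiseAssumption ν) (v : ℝ) : 0 < noiseCDF ν v :=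
  (cdf_nonneg ν (v - 1)).trans_lt (hν.strictMono (by linarith))

lemma cdf_lt_one (hν : NoiseAssumption ν) (v : ℝ) : noiseCDF ν v < 1 :=
  (hν.strictMono (by linarith : v < v + 1)).trans_le (cdf_le_one ν (v + 1))

lemma tail_pos (hν : NoiseAssumption ν) (v : ℝ) : 0 < 1 - noiseCDF ν v := by
  linarith [hν.cdf_lt_one v]

lemma hasDerivAt_cdf (hν : NoiseAssumption ν) (v : ℝ) :
    HasDerivAt (noiseCDF ν) (noisePDF ν v) v := (hν.differentiable_cdf v).hasDerivAt

lemma hasDerivAt_pdf (hν : NoiseAssumption ν) (v : ℝ) :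
    HasDerivAt (noisePDF ν) (deriv (noisePDF ν) v) v := (hν.differentiable_pdf v).hasDerivAt

lemma hasDerivAt_deriv_pdf (hν : NoiseAssumption ν) (v : ℝ) :
    HasDerivAt (deriv (noisePDF ν)) (deriv (deriv (noisePDF ν)) v) v :=
  (hν.differentiable_deriv_pdf v).hasDerivAt

lemma locallyBounded_deriv2_pdf (hν : NoiseAssumption ν) :
    LocallyBounded (deriv (deriv (noisePDF ν))) := by
  intro R
  obtain ⟨_, _, M, hM⟩ := hν.locally_bounded R
  exact ⟨|M| + 1, by positivity, fun v hv => by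
    linarith [(hM v (abs_le.mp hv)).2.2, le_abs_self M]⟩

lemma hasDerivAt_log_cdf (hν : NoiseAssumption ν) (v : ℝ) :
    HasDerivAt (fun v => Real.log (noiseCDF ν v)) (noisePDF ν v / noiseCDF ν v) v :=
  (hν.hasDerivAt_cdf v).log (hν.cdf_pos v).ne'

lemma hasDerivAt_log_tail (hν : NoiseAssumption ν) (v : ℝ) :
    HasDerivAt (fun v => Real.log (1 - noiseCDF ν v)) (-noisePDF ν v / (1 - noiseCDF ν v)) v :=
  ((hν.hasDerivAt_cdf v).const_sub 1).log (hν.tail_pos v).ne'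

lemma pdf_pos (hν : NoiseAssumption ν) (v : ℝ) : 0 < noisePDF ν v := by
  have h := hν.logConcave_cdf.slope_le_of_hasDerivAt (mem_univ v) (mem_univ (v + 1)) (by linarith)
    (hν.hasDerivAt_log_cdf v)
  have h2 : 0 < slope (fun v => Real.log (noiseCDF ν v)) v (v + 1) := by
    rw [slope_def_field]
    have := Real.log_lt_log (hν.cdf_pos v) (hν.strictMono (by linarith : v < v + 1))
    exact div_pos (by linarith) (by linarith)
  have := h2.trans_le h
  rwa [div_pos_iff_of_pos_right (hν.cdf_pos v)] at this

lemma continuous_cdf (hν : NoiseAssumption ν) : Continuous (noiseCDF ν) :=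
  hν.differentiable_cdf.continuous

lemma continuous_pdf (hν : NoiseAssumption ν) : Continuous (noisePDF ν) :=
  hν.differentiable_pdf.continuous

lemma continuous_deriv_pdf (hν : NoiseAssumption ν) : Continuous (deriv (noisePDF ν)) :=
  hν.differentiable_deriv_pdf.continuous

lemma exists_pdf_lower_bound (hν : NoiseAssumption ν) (R : ℝ) :
    ∃ c : ℝ, 0 < c ∧ ∀ v, |v| ≤ R → c ≤ noisePDF ν v := by
  obtain ⟨M, hM, h⟩ := LocallyBounded.of_continuous (h := fun v => (noisePDF ν v)⁻¹)
    (hν.continuous_pdf.inv₀ fun v => (hν.pdf_pos v).ne') R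
  refine ⟨M⁻¹, by positivity, fun v hv => ?_⟩
  have := h v hv
  rw [abs_of_pos (inv_pos.mpr (hν.pdf_pos v))] at this
  exact inv_le_of_inv_le₀ (hν.pdf_pos v) this

end NoiseAssumption

/-! ### The log-likelihood of one observation -/

/-- Log-likelihood of the outcome `y` at `u = p - θᵀ x`. -/
noncomputable def logLik (ν : Measure ℝ) (y : Bool) (u : ℝ) : ℝ :=
  if y = true then Real.log (1 - noiseCDF ν u) else Real.log (noiseCDF ν u)

/-- First derivative of `logLik`. -/
noncomputable def logLikDeriv (ν : Measure ℝ) (y : Bool) (u : ℝ) : ℝ :=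
  if y = true then -noisePDF ν u / (1 - noiseCDF ν u) else noisePDF ν u / noiseCDF ν u

/-- Second derivative of `logLik`. -/
noncomputable def logLikDeriv2 (ν : Measure ℝ) (y : Bool) (u : ℝ) : ℝ :=
  if y = true
    then -deriv (noisePDF ν) u / (1 - noiseCDF ν u) - (-noisePDF ν u / (1 - noiseCDF ν u)) ^ 2
    else deriv (noisePDF ν) u / noiseCDF ν u - (noisePDF ν u / noiseCDF ν u) ^ 2

namespace NoiseAssumption

variable {ν : Measure ℝ}

lemma concaveOn_logLik (hν : NoiseAssumption ν) (y : Bool) :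
    ConcaveOn ℝ univ (logLik ν y) := by
  cases y
  · exact hν.logConcave_cdf
  · exact hν.logConcave_tail

lemma continuous_logLikDeriv (hν : NoiseAssumption ν) (y : Bool) :
    Continuous (logLikDeriv ν y) := by
  have h1 := hν.continuous_cdf
  have h2 := hν.continuous_pdf
  cases y
  · exact h2.div h1 fun v => (hν.cdf_pos v).ne'
  · exact h2.neg.div (continuous_const.sub h1) fun v => (hν.tail_pos v).ne'

lemma continuous_logLikDeriv2 (hν : NoiseAssumption ν) (y : Bool) :
    Continuous (logLikDeriv2 ν y) := by
  have h1 := hν.continuous_cdf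
  have h2 := hν.continuous_pdf
  have h3 := hν.continuous_deriv_pdf
  have hF : ∀ v, noiseCDF ν v ≠ 0 := fun v => (hν.cdf_pos v).ne'
  have hT : ∀ v, 1 - noiseCDF ν v ≠ 0 := fun v => (hν.tail_pos v).ne'
  have h4 := (continuous_const (y := (1 : ℝ))).sub h1
  cases y
  · exact (h3.div h1 hF).sub ((h2.div h1 hF).pow 2)
  · exact (h3.neg.div h4 hT).sub ((h2.neg.div h4 hT).pow 2)

lemma hasDerivAt_logLik (hν : NoiseAssumption ν) (y : Bool) (v : ℝ) :
    HasDerivAt (logLik ν y) (logLikDeriv ν y v) v := by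
  cases y
  · exact hν.hasDerivAt_log_cdf v
  · exact hν.hasDerivAt_log_tail v

lemma hasDerivAt_logLikDeriv (hν : NoiseAssumption ν) (y : Bool) (v : ℝ) :
    HasDerivAt (logLikDeriv ν y) (logLikDeriv2 ν y v) v := by
  have hF := (hν.cdf_pos v).ne'
  have hT := (hν.tail_pos v).ne'
  cases y
  · refine ((hν.hasDerivAt_pdf v).div (hν.hasDerivAt_cdf v) hF).congr_deriv ?_
    simp only [logLikDeriv2, Bool.false_eq_true, if_false]
    field_simp
  · refine ((hν.hasDerivAt_pdf v).neg.div ((hν.hasDerivAt_cdf v).const_sub 1) hT).congr_deriv ?_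
    simp only [logLikDeriv2, if_true, Pi.neg_apply]
    field_simp

lemma exists_deriv_logLikDeriv2 (hν : NoiseAssumption ν) (y : Bool) :
    ∃ h3 : ℝ → ℝ, (∀ v, HasDerivAt (logLikDeriv2 ν y) (h3 v) v) ∧ LocallyBounded h3 := by
  have h1 := hν.continuous_cdf
  have h2 := hν.continuous_pdf
  have h3 := hν.continuous_deriv_pdf
  have hF : ∀ v, noiseCDF ν v ≠ 0 := fun v => (hν.cdf_pos v).ne'
  have hT : ∀ v, 1 - noiseCDF ν v ≠ 0 := fun v => (hν.tail_pos v).ne'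
  have hT' := (continuous_const (y := (1 : ℝ))).sub h1
  cases y
  · refine ⟨fun v => (noiseCDF ν v)⁻¹ * deriv (deriv (noisePDF ν)) v +
      (-deriv (noisePDF ν) v * noisePDF ν v / noiseCDF ν v ^ 2
        - 2 * (noisePDF ν v / noiseCDF ν v) * logLikDeriv2 ν false v), fun v => ?_, ?_⟩
    · have d := ((hν.hasDerivAt_deriv_pdf v).div (hν.hasDerivAt_cdf v) (hF v)).sub
        ((hν.hasDerivAt_logLikDeriv false v).pow 2)
      refine d.congr_deriv ?_
      simp [logLikDeriv, logLikDeriv2]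
      have := hF v
      field_simp
      ring
    · refine ((LocallyBounded.of_continuous (h1.inv₀ hF)).mul hν.locallyBounded_deriv2_pdf).add
        (LocallyBounded.of_continuous ?_)
      exact ((h3.neg.mul h2).div (h1.pow 2) fun v => pow_ne_zero 2 (hF v)).sub
        ((continuous_const.mul (h2.div h1 hF)).mul (hν.continuous_logLikDeriv2 false))
  · refine ⟨fun v => (-(1 - noiseCDF ν v)⁻¹) * deriv (deriv (noisePDF ν)) v +
      (-deriv (noisePDF ν) v * noisePDF ν v / (1 - noiseCDF ν v) ^ 2
        + 2 * (noisePDF ν v / (1 - noiseCDF ν v)) * logLikDeriv2 ν true v), fun v => ?_, ?_⟩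
    · have d := ((hν.hasDerivAt_deriv_pdf v).neg.div ((hν.hasDerivAt_cdf v).const_sub 1) (hT v)).sub
        ((hν.hasDerivAt_logLikDeriv true v).pow 2)
      refine d.congr_deriv ?_
      simp [logLikDeriv, logLikDeriv2]
      have := hT v
      field_simp
      ring
    · refine ((LocallyBounded.of_continuous (hT'.inv₀ hT).neg).mul
        hν.locallyBounded_deriv2_pdf).add (LocallyBounded.of_continuous ?_)
      exact ((h3.neg.mul h2).div (hT'.pow 2) fun v => pow_ne_zero 2 (hT v)).add
        ((continuous_const.mul (h2.div hT' hT)).mul (hν.continuous_logLikDeriv2 true))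

/-- Uniform local bounds for the log-likelihood of one observation. -/
lemma exists_logLik_bounds (hν : NoiseAssumption ν) (R : ℝ) :
    ∃ M : ℝ, 0 < M ∧ ∀ y u, |u| ≤ R → |logLikDeriv ν y u| ≤ M ∧ |logLikDeriv2 ν y u| ≤ M ∧
      ∀ t, |t| ≤ 1 → |logLik ν y (u - t) -
        (logLik ν y u - logLikDeriv ν y u * t + logLikDeriv2 ν y u * t ^ 2 / 2)| ≤ M * |t| ^ 3 := by
  have main : ∀ y, ∃ M : ℝ, 0 < M ∧ ∀ u, |u| ≤ R → |logLikDeriv ν y u| ≤ M ∧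
      |logLikDeriv2 ν y u| ≤ M ∧ ∀ t, |t| ≤ 1 → |logLik ν y (u - t) -
        (logLik ν y u - logLikDeriv ν y u * t + logLikDeriv2 ν y u * t ^ 2 / 2)| ≤ M * |t| ^ 3 := by
    intro y
    obtain ⟨M1, p1, b1⟩ := LocallyBounded.of_continuous (hν.continuous_logLikDeriv y) R
    obtain ⟨M2, p2, b2⟩ := LocallyBounded.of_continuous (hν.continuous_logLikDeriv2 y) R
    obtain ⟨h3, d3, l3⟩ := hν.exists_deriv_logLikDeriv2 y
    obtain ⟨M3, p3, b3⟩ := l3 (R + 1)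
    refine ⟨M1 + M2 + M3, by positivity, fun u hu => ⟨(b1 u hu).trans (by linarith),
      (b2 u hu).trans (by linarith), fun t ht => ?_⟩⟩
    exact taylor_two_remainder (hν.hasDerivAt_logLik y) (hν.hasDerivAt_logLikDeriv y) d3
      (fun v hv => (b3 v hv).trans (by linarith)) hu ht
  obtain ⟨M, hM, h⟩ := main true
  obtain ⟨N, hN, k⟩ := main false
  refine ⟨M + N, by positivity, fun y u hu => ?_⟩
  cases y
  · obtain ⟨a, b, c⟩ := k u hu
    exact ⟨by linarith, by linarith, fun t ht => (c t ht).trans (by gcongr; linarith)⟩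
  · obtain ⟨a, b, c⟩ := h u hu
    exact ⟨by linarith, by linarith, fun t ht => (c t ht).trans (by gcongr; linarith)⟩

lemma mean_logLikDeriv (hν : NoiseAssumption ν) (u : ℝ) :
    (1 - noiseCDF ν u) * logLikDeriv ν true u + noiseCDF ν u * logLikDeriv ν false u = 0 := by
  have hF := (hν.cdf_pos u).ne'
  have hT := (hν.tail_pos u).ne'
  simp only [logLikDeriv, Bool.false_eq_true, if_false, if_true]
  field_simp
  ring

lemma mean_logLikDeriv2_le (hν : NoiseAssumption ν) (u : ℝ) :
    (1 - noiseCDF ν u) * logLikDeriv2 ν true u + noiseCDF ν u * logLikDeriv2 ν false u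
      ≤ -noisePDF ν u ^ 2 := by
  have hF := hν.cdf_pos u
  have hT := hν.tail_pos u
  have e : (1 - noiseCDF ν u) * logLikDeriv2 ν true u + noiseCDF ν u * logLikDeriv2 ν false u
      = -(noisePDF ν u ^ 2 / (1 - noiseCDF ν u)) - noisePDF ν u ^ 2 / noiseCDF ν u := by
    simp only [logLikDeriv2, Bool.false_eq_true, if_false, if_true]
    have := hF.ne'
    have := hT.ne'
    field_simp
    ring
  rw [e]
  have h1 : 0 ≤ noisePDF ν u ^ 2 / (1 - noiseCDF ν u) := by positivity
  have h2 : noisePDF ν u ^ 2 ≤ noisePDF ν u ^ 2 / noiseCDF ν u :=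
    le_div_self (sq_nonneg _) hF (hν.cdf_lt_one u).le
  linarith

/-! ### Virtual valuation and pricing function -/

lemma antitone_inverse_hazard (hν : NoiseAssumption ν) :
    Antitone (fun v => (1 - noiseCDF ν v) / noisePDF ν v) := by
  intro a b hab
  have h := hν.logConcave_tail.antitoneOn_deriv
    (fun v _ => (hν.hasDerivAt_log_tail v).differentiableAt) (mem_univ a) (mem_univ b) hab
  rw [(hν.hasDerivAt_log_tail a).deriv, (hν.hasDerivAt_log_tail b).deriv, neg_div, neg_div,
    neg_le_neg_iff] at h
  have := inv_anti₀ (div_pos (hν.pdf_pos a) (hν.tail_pos a)) h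
  simpa [inv_div] using this

/-- Derivative of the virtual valuation function. -/
lemma hasDerivAt_virtualValuation (hν : NoiseAssumption ν) (v : ℝ) :
    HasDerivAt (virtualValuation ν)
      (2 + (1 - noiseCDF ν v) * deriv (noisePDF ν) v / noisePDF ν v ^ 2) v := by
  have hf := (hν.pdf_pos v).ne'
  refine ((hasDerivAt_id v).sub
    (((hν.hasDerivAt_cdf v).const_sub 1).div (hν.hasDerivAt_pdf v) hf)).congr_deriv ?_
  field_simp
  ring

lemma one_le_deriv_virtualValuation (hν : NoiseAssumption ν) (v : ℝ) :
    1 ≤ 2 + (1 - noiseCDF ν v) * deriv (noisePDF ν) v / noisePDF ν v ^ 2 := by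
  have hf := (hν.pdf_pos v).ne'
  have d := ((hν.hasDerivAt_cdf v).const_sub 1).div (hν.hasDerivAt_pdf v) hf
  have := hν.antitone_inverse_hazard.deriv_nonpos (x := v)
  rw [show deriv (fun v => (1 - noiseCDF ν v) / noisePDF ν v) v = _ from d.deriv] at this
  have e : (-noisePDF ν v * noisePDF ν v - (1 - noiseCDF ν v) * deriv (noisePDF ν) v) /
      noisePDF ν v ^ 2 = -1 - (1 - noiseCDF ν v) * deriv (noisePDF ν) v / noisePDF ν v ^ 2 := by
    field_simp
  linarith

lemma sub_le_virtualValuation_sub (hν : NoiseAssumption ν) {a b : ℝ} (hab : a ≤ b) :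
    b - a ≤ virtualValuation ν b - virtualValuation ν a := by
  have := hν.antitone_inverse_hazard hab
  simp only [virtualValuation]
  simp only at this
  linarith

lemma abs_sub_le_virtualValuation (hν : NoiseAssumption ν) (a b : ℝ) :
    |a - b| ≤ |virtualValuation ν a - virtualValuation ν b| := by
  rcases le_total a b with h | h
  · rw [abs_sub_comm, abs_sub_comm (virtualValuation ν a), abs_of_nonneg (sub_nonneg.mpr h)]
    exact (hν.sub_le_virtualValuation_sub h).trans (le_abs_self _)
  · rw [abs_of_nonneg (sub_nonneg.mpr h)]
    exact (hν.sub_le_virtualValuation_sub h).trans (le_abs_self _)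

lemma continuous_virtualValuation (hν : NoiseAssumption ν) : Continuous (virtualValuation ν) :=
  continuous_iff_continuousAt.mpr fun v => (hν.hasDerivAt_virtualValuation v).continuousAt

lemma surjective_virtualValuation (hν : NoiseAssumption ν) :
    Function.Surjective (virtualValuation ν) := by
  refine hν.continuous_virtualValuation.surjective ?_ ?_
  · refine Filter.tendsto_atTop_mono' _ ?_
      (Filter.tendsto_atTop_add_const_right _ (virtualValuation ν 0) Filter.tendsto_id)
    filter_upwards [Filter.eventually_ge_atTop 0] with v hv
    have := hν.sub_le_virtualValuation_sub hv
    simp only [id]; linarith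
  · refine Filter.tendsto_atBot_mono' _ ?_
      (Filter.tendsto_atBot_add_const_right _ (virtualValuation ν 0) Filter.tendsto_id)
    filter_upwards [Filter.eventually_le_atBot 0] with v hv
    have := hν.sub_le_virtualValuation_sub hv
    simp only [id]; linarith

lemma virtualValuation_invFun (hν : NoiseAssumption ν) (y : ℝ) :
    virtualValuation ν (Function.invFun (virtualValuation ν) y) = y :=
  Function.rightInverse_invFun hν.surjective_virtualValuation y

lemma abs_invFun_virtualValuation_sub_le (hν : NoiseAssumption ν) (a b : ℝ) :
    |Function.invFun (virtualValuation ν) a - Function.invFun (virtualValuation ν) b|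
      ≤ |a - b| := by
  have := hν.abs_sub_le_virtualValuation (Function.invFun (virtualValuation ν) a)
    (Function.invFun (virtualValuation ν) b)
  rwa [hν.virtualValuation_invFun, hν.virtualValuation_invFun] at this

lemma continuous_invFun_virtualValuation (hν : NoiseAssumption ν) :
    Continuous (Function.invFun (virtualValuation ν)) := by
  refine (LipschitzWith.of_dist_le_mul (K := 1) fun a b => ?_).continuous
  simpa [Real.dist_eq] using hν.abs_invFun_virtualValuation_sub_le a b

/-- Derivative of the pricing function. -/
lemma hasDerivAt_pricing (hν : NoiseAssumption ν) (v : ℝ) :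
    HasDerivAt (pricing ν) (1 - (2 + (1 - noiseCDF ν (Function.invFun (virtualValuation ν) (-v))) *
      deriv (noisePDF ν) (Function.invFun (virtualValuation ν) (-v)) /
        noisePDF ν (Function.invFun (virtualValuation ν) (-v)) ^ 2)⁻¹) v := by
  have h := HasDerivAt.of_local_left_inverse (f := virtualValuation ν)
    (g := Function.invFun (virtualValuation ν)) (a := -v)
    hν.continuous_invFun_virtualValuation.continuousAt (hν.hasDerivAt_virtualValuation _)
    (by linarith [hν.one_le_deriv_virtualValuation (Function.invFun (virtualValuation ν) (-v))])
    (Filter.Eventually.of_forall hν.virtualValuation_invFun)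
  refine ((hasDerivAt_id v).add (h.comp v (hasDerivAt_neg v))).congr_deriv ?_
  ring

lemma deriv_pricing_mem (hν : NoiseAssumption ν) (v : ℝ) : deriv (pricing ν) v ∈ Icc (0 : ℝ) 1 := by
  rw [(hν.hasDerivAt_pricing v).deriv]
  have h := hν.one_le_deriv_virtualValuation (Function.invFun (virtualValuation ν) (-v))
  have h1 := inv_le_one_of_one_le₀ h
  have h2 := inv_nonneg.mpr (zero_le_one.trans h)
  constructor <;> linarith

lemma abs_deriv_pricing_le (hν : NoiseAssumption ν) (v : ℝ) : |deriv (pricing ν) v| ≤ 1 := by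
  have := hν.deriv_pricing_mem v
  rw [abs_of_nonneg this.1]; exact this.2

lemma abs_pricing_sub_le (hν : NoiseAssumption ν) (a b : ℝ) :
    |pricing ν a - pricing ν b| ≤ |a - b| := by
  have := abs_sub_le_of_hasDerivAt (R := max |a| |b|) (K := 1) (h := pricing ν)
    (fun v _ => (hν.hasDerivAt_pricing v).differentiableAt.hasDerivAt)
    (fun v _ => hν.abs_deriv_pricing_le v) (le_max_left |a| |b|) (le_max_right |a| |b|)
  simpa using this

lemma continuous_pricing (hν : NoiseAssumption ν) : Continuous (pricing ν) :=
  continuous_iff_continuousAt.mpr fun v => (hν.hasDerivAt_pricing v).continuousAt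

/-- The derivative of the pricing function is Lipschitz on bounded intervals. -/
lemma exists_deriv_pricing_lipschitz (hν : NoiseAssumption ν) (R : ℝ) :
    ∃ L : ℝ, 0 < L ∧ ∀ a b, |a| ≤ R → |b| ≤ R →
      |deriv (pricing ν) a - deriv (pricing ν) b| ≤ L * |a - b| := by
  set ψ := Function.invFun (virtualValuation ν) with hψ
  set D : ℝ → ℝ := fun v => 2 + (1 - noiseCDF ν v) * deriv (noisePDF ν) v / noisePDF ν v ^ 2
  have hf : ∀ v, noisePDF ν v ≠ 0 := fun v => (hν.pdf_pos v).ne'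
  have hD : ∀ v, HasDerivAt D ((1 - noiseCDF ν v) / noisePDF ν v ^ 2 *
      deriv (deriv (noisePDF ν)) v + (-deriv (noisePDF ν) v / noisePDF ν v -
        2 * (1 - noiseCDF ν v) * deriv (noisePDF ν) v ^ 2 / noisePDF ν v ^ 3)) v := by
    intro v
    refine (((((hν.hasDerivAt_cdf v).const_sub 1).mul (hν.hasDerivAt_deriv_pdf v)).div
      ((hν.hasDerivAt_pdf v).pow 2) (pow_ne_zero 2 (hf v))).const_add 2).congr_deriv ?_
    have := hf v
    simp
    field_simp
    ring
  have hb : LocallyBounded (fun v => (1 - noiseCDF ν v) / noisePDF ν v ^ 2 *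
      deriv (deriv (noisePDF ν)) v + (-deriv (noisePDF ν) v / noisePDF ν v -
        2 * (1 - noiseCDF ν v) * deriv (noisePDF ν) v ^ 2 / noisePDF ν v ^ 3)) := by
    have h1 := (continuous_const (y := (1 : ℝ))).sub hν.continuous_cdf
    have h2 := hν.continuous_pdf
    have h3 := hν.continuous_deriv_pdf
    refine ((LocallyBounded.of_continuous (h1.div (h2.pow 2) fun v => pow_ne_zero 2 (hf v))).mul
      hν.locallyBounded_deriv2_pdf).add (LocallyBounded.of_continuous ?_)
    exact (h3.neg.div h2 hf).sub (((continuous_const.mul h1).mul (h3.pow 2)).div (h2.pow 3)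
      fun v => pow_ne_zero 3 (hf v))
  obtain ⟨L, hL, hLb⟩ := hb (R + |ψ 0|)
  refine ⟨L, hL, fun a b ha hb => ?_⟩
  have bd : ∀ a, |a| ≤ R → |ψ (-a)| ≤ R + |ψ 0| := by
    intro a ha
    have h1 := hν.abs_invFun_virtualValuation_sub_le (-a) 0
    have h2 := abs_sub_abs_le_abs_sub (ψ (-a)) (ψ 0)
    rw [sub_zero, abs_neg] at h1
    linarith
  have h1 := abs_sub_le_of_hasDerivAt (fun v _ => hD v) hLb (bd a ha) (bd b hb)
  have h2 : |ψ (-a) - ψ (-b)| ≤ |a - b| := by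
    have := hν.abs_invFun_virtualValuation_sub_le (-a) (-b)
    rwa [neg_sub_neg, abs_sub_comm b a] at this
  have ga : deriv (pricing ν) a = 1 - (D (ψ (-a)))⁻¹ := (hν.hasDerivAt_pricing a).deriv
  have gb : deriv (pricing ν) b = 1 - (D (ψ (-b)))⁻¹ := (hν.hasDerivAt_pricing b).deriv
  have pa : 1 ≤ D (ψ (-a)) := hν.one_le_deriv_virtualValuation _
  have pb : 1 ≤ D (ψ (-b)) := hν.one_le_deriv_virtualValuation _
  have e : deriv (pricing ν) a - deriv (pricing ν) b =
      (D (ψ (-a)) - D (ψ (-b))) / (D (ψ (-a)) * D (ψ (-b))) := by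
    rw [ga, gb]; field_simp; ring
  rw [e, abs_div, abs_of_pos (by positivity : 0 < D (ψ (-a)) * D (ψ (-b)))]
  have p1 : 1 ≤ D (ψ (-a)) * D (ψ (-b)) := one_le_mul_of_one_le_of_one_le pa pb
  calc _ ≤ |D (ψ (-a)) - D (ψ (-b))| := div_le_self (abs_nonneg _) p1
    _ ≤ L * |ψ (-a) - ψ (-b)| := h1
    _ ≤ L * |a - b| := by gcongr

/-- First-order condition for the clairvoyant price. -/
lemma pricing_eq (hν : NoiseAssumption ν) (m : ℝ) :
    pricing ν m = (1 - noiseCDF ν (pricing ν m - m)) / noisePDF ν (pricing ν m - m) := by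
  have h := hν.virtualValuation_invFun (-m)
  have e : pricing ν m - m = Function.invFun (virtualValuation ν) (-m) := by
    simp [pricing]
  rw [e]
  simp only [virtualValuation] at h ⊢
  simp only [pricing]
  linarith

lemma pricing_pos (hν : NoiseAssumption ν) (m : ℝ) : 0 < pricing ν m := by
  rw [hν.pricing_eq]
  exact div_pos (hν.tail_pos _) (hν.pdf_pos _)

lemma pricing_le (hν : NoiseAssumption ν) (m : ℝ) : pricing ν m ≤ pricing ν 0 + |m| := by
  have := hν.abs_pricing_sub_le m 0
  rw [sub_zero] at this
  linarith [le_abs_self (pricing ν m - pricing ν 0)]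

/-- The clairvoyant revenue exceeds the revenue of the price `p` by at most a multiple of the
squared distance of `p` from the clairvoyant price. -/
lemma exists_revenue_quadratic (hν : NoiseAssumption ν) (R : ℝ) :
    ∃ K : ℝ, 0 < K ∧ ∀ m p, |m| ≤ R → 0 ≤ p →
      pricing ν m * (1 - noiseCDF ν (pricing ν m - m)) - p * (1 - noiseCDF ν (p - m))
        ≤ K * (p - pricing ν m) ^ 2 := by
  set G := pricing ν 0 + |R| with hG
  have hGp : 0 < G := by have := hν.pricing_pos 0; positivity
  have hGb : ∀ m, |m| ≤ R → pricing ν m ≤ G := fun m hm =>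
    (hν.pricing_le m).trans (by rw [hG]; linarith [le_abs_self R])
  have hlb : LocallyBounded (noisePDF ν) := .of_continuous hν.continuous_pdf
  have hlb1 : LocallyBounded (deriv (noisePDF ν)) := .of_continuous hν.continuous_deriv_pdf
  obtain ⟨M0, p0, b0⟩ := hlb (G + 1 + R)
  obtain ⟨M1, p1, b1⟩ := hlb1 (G + 1 + R)
  refine ⟨G + 2 * M0 + (G + 1) * M1, by positivity, fun m p hm hp => ?_⟩
  have hg := hν.pricing_pos m
  have hgG := hGb m hm
  set q := pricing ν m with hq
  by_cases h1 : 1 ≤ |p - q|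
  · have hsq : 1 ≤ (p - q) ^ 2 := by rw [← sq_abs]; nlinarith
    have hpF : 0 ≤ p * (1 - noiseCDF ν (p - m)) := mul_nonneg hp (hν.tail_pos _).le
    have hqF : q * (1 - noiseCDF ν (q - m)) ≤ G := by
      nlinarith [hν.tail_pos (q - m), hν.cdf_pos (q - m)]
    have : G * 1 ≤ G * (p - q) ^ 2 := by gcongr
    nlinarith [sq_nonneg (p - q), mul_pos hGp p1]
  · push Not at h1
    obtain ⟨ha, hb⟩ := abs_lt.mp h1
    have dr : ∀ s, HasDerivAt (fun s => (q + s) * (1 - noiseCDF ν (q + s - m)))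
        ((1 - noiseCDF ν (q + s - m)) - (q + s) * noisePDF ν (q + s - m)) s := by
      intro s
      have d1 : HasDerivAt (fun s => q + s) 1 s := by simpa using (hasDerivAt_id s).const_add q
      have d2 : HasDerivAt (fun s => q + s - m) 1 s := d1.sub_const m
      refine (d1.mul (((hν.hasDerivAt_cdf (q + s - m)).comp s d2).const_sub 1)).congr_deriv ?_
      simp [noiseCDF]
      ring
    have dr2 : ∀ s, HasDerivAt
        (fun s => (1 - noiseCDF ν (q + s - m)) - (q + s) * noisePDF ν (q + s - m))
        (-2 * noisePDF ν (q + s - m) - (q + s) * deriv (noisePDF ν) (q + s - m)) s := by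
      intro s
      have d1 : HasDerivAt (fun s => q + s) 1 s := by simpa using (hasDerivAt_id s).const_add q
      have d2 : HasDerivAt (fun s => q + s - m) 1 s := d1.sub_const m
      refine ((((hν.hasDerivAt_cdf (q + s - m)).comp s d2).const_sub 1).sub
        (d1.mul ((hν.hasDerivAt_pdf (q + s - m)).comp s d2))).congr_deriv ?_
      simp only [noisePDF, Function.comp_apply, mul_one, one_mul]
      ring
    have hm' := abs_le.mp hm
    have bnd : ∀ s, |s| ≤ |p - q| →
        |-2 * noisePDF ν (q + s - m) - (q + s) * deriv (noisePDF ν) (q + s - m)|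
          ≤ 2 * M0 + (G + 1) * M1 := by
      intro s hs
      have hs1 := abs_le.mp (hs.trans h1.le)
      have hr : |q + s - m| ≤ G + 1 + R := by rw [abs_le]; constructor <;> linarith
      refine (abs_sub _ _).trans (add_le_add ?_ ?_)
      · rw [abs_mul]; norm_num; exact b0 _ hr
      · rw [abs_mul]
        exact mul_le_mul (by rw [abs_le]; constructor <;> linarith) (b1 _ hr) (abs_nonneg _)
          (by linarith)
    have z : (1 - noiseCDF ν (q + 0 - m)) - (q + 0) * noisePDF ν (q + 0 - m) = 0 := by
      have := hν.pricing_eq m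
      rw [← hq, eq_div_iff (hν.pdf_pos _).ne'] at this
      simp; linarith
    have h00 : |(0 : ℝ)| ≤ |p - q| := by simp
    have step1 : ∀ s, |s| ≤ |p - q| →
        |(1 - noiseCDF ν (q + s - m)) - (q + s) * noisePDF ν (q + s - m)|
          ≤ (2 * M0 + (G + 1) * M1) * |p - q| := by
      intro s hs
      have := abs_sub_le_of_hasDerivAt (fun v _ => dr2 v) bnd hs h00
      rw [z, sub_zero, sub_zero] at this
      exact this.trans (by gcongr)
    have step2 := abs_sub_le_of_hasDerivAt (fun v _ => dr v) step1 (le_refl |p - q|) h00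
    rw [sub_zero, add_sub_cancel, add_zero, mul_assoc, ← sq, sq_abs] at step2
    have := (abs_le.mp step2).1
    nlinarith [sq_nonneg (p - q)]

end NoiseAssumption

/-! ### Euclidean norm of coordinate vectors -/

/-- Euclidean norm of a coordinate vector. -/
noncomputable def l2 {n : ℕ} (v : Fin n → ℝ) : ℝ := Real.sqrt (v ⬝ᵥ v)

variable {n d : ℕ}

lemma dotProduct_self_nonneg (v : Fin n → ℝ) : 0 ≤ v ⬝ᵥ v :=
  Finset.sum_nonneg fun i _ => mul_self_nonneg (v i)

lemma l2_nonneg (v : Fin n → ℝ) : 0 ≤ l2 v := Real.sqrt_nonneg _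

lemma l2_sq (v : Fin n → ℝ) : l2 v ^ 2 = v ⬝ᵥ v := Real.sq_sqrt (dotProduct_self_nonneg v)

lemma norm_toLp_eq_l2 (v : Fin n → ℝ) : ‖WithLp.toLp 2 v‖ = l2 v := by
  rw [EuclideanSpace.norm_eq, l2]
  congr 1
  simp [dotProduct, sq]

lemma abs_dotProduct_le (a b : Fin n → ℝ) : |a ⬝ᵥ b| ≤ l2 a * l2 b := by
  apply abs_le_of_sq_le_sq
  · rw [mul_pow, l2_sq, l2_sq]
    simpa [dotProduct, sq] using Finset.sum_mul_sq_le_sq_mul_sq Finset.univ a b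
  · exact mul_nonneg (l2_nonneg _) (l2_nonneg _)

lemma l2_sub_le (a b : Fin n → ℝ) : l2 (a - b) ≤ l2 a + l2 b := by
  rw [← norm_toLp_eq_l2, ← norm_toLp_eq_l2, ← norm_toLp_eq_l2, WithLp.toLp_sub]
  exact norm_sub_le _ _

lemma abs_apply_le_l2 (v : Fin n → ℝ) (i : Fin n) : |v i| ≤ l2 v := by
  rw [l2]
  apply Real.abs_le_sqrt
  rw [sq]
  exact Finset.single_le_sum (f := fun i => v i * v i) (fun i _ => mul_self_nonneg (v i))
    (Finset.mem_univ i)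

lemma l2_le_sum_abs (v : Fin n → ℝ) : l2 v ≤ ∑ i, |v i| := by
  rw [l2]
  apply Real.sqrt_le_iff.mpr ⟨Finset.sum_nonneg fun i _ => abs_nonneg _, ?_⟩
  rw [dotProduct, sq, Finset.sum_mul]
  refine Finset.sum_le_sum fun i _ => ?_
  rw [← abs_mul_abs_self]
  exact mul_le_mul_of_nonneg_left
    (Finset.single_le_sum (f := fun i => |v i|) (fun i _ => abs_nonneg _) (Finset.mem_univ i))
    (abs_nonneg _)

lemma l2_le_of_mem_paramSet {W : ℝ} {θ : Fin (d + 1) → ℝ} (h : θ ∈ paramSet d W) : l2 θ ≤ W :=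
  (l2_le_sum_abs θ).trans h

lemma l2_slopePart_le (θ : Fin (d + 1) → ℝ) : l2 (slopePart θ) ≤ l2 θ := by
  apply Real.sqrt_le_sqrt
  rw [dotProduct, dotProduct, Fin.sum_univ_castSucc (n := d)]
  exact le_add_of_nonneg_right (mul_self_nonneg _)

lemma slopePart_sub (θ θ' : Fin (d + 1) → ℝ) :
    slopePart (θ - θ') = slopePart θ - slopePart θ' := rfl

lemma dotProduct_augment (θ : Fin (d + 1) → ℝ) (x : Fin d → ℝ) :
    θ ⬝ᵥ augment x = slopePart θ ⬝ᵥ x + θ (Fin.last d) := by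
  simp [dotProduct, Fin.sum_univ_castSucc, augment, slopePart]

lemma dotProduct_augment_sub (θ : Fin (d + 1) → ℝ) (x y : Fin d → ℝ) :
    θ ⬝ᵥ augment (x - y) = θ ⬝ᵥ augment x - slopePart θ ⬝ᵥ y := by
  rw [dotProduct_augment, dotProduct_augment, dotProduct_sub]
  ring

/-! ### Smallest eigenvalues -/

lemma minEigenvalue_mul_le {M : Matrix (Fin n) (Fin n) ℝ} (hM : M.IsHermitian) {lam : ℝ}
    (h : lam ≤ minEigenvalue M) (v : Fin n → ℝ) : lam * (v ⬝ᵥ v) ≤ v ⬝ᵥ M *ᵥ v := by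
  have hspec : ∀ r ∈ spectrum ℝ M, lam ≤ r := fun r hr => by
    refine h.trans (csInf_le ?_ hr)
    rw [hM.spectrum_real_eq_range_eigenvalues]
    exact (Set.finite_range _).bddBelow
  have hH : (M - algebraMap ℝ (Matrix (Fin n) (Fin n) ℝ) lam).IsHermitian := by
    refine hM.sub ?_
    rw [Matrix.algebraMap_eq_diagonal]
    exact Matrix.isHermitian_diagonal _
  have hP : (M - algebraMap ℝ (Matrix (Fin n) (Fin n) ℝ) lam).PosSemidef := by
    rw [hH.posSemidef_iff_eigenvalues_nonneg]
    intro i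
    have hi : hH.eigenvalues i ∈ spectrum ℝ (M - algebraMap ℝ (Matrix (Fin n) (Fin n) ℝ) lam) := by
      rw [hH.spectrum_real_eq_range_eigenvalues]; exact ⟨i, rfl⟩
    rw [← spectrum.sub_singleton_eq] at hi
    obtain ⟨r, hr, s, hs, e⟩ := hi
    rw [mem_singleton_iff] at hs
    have := hspec r hr
    simp only at e
    simp only [Pi.zero_apply]
    linarith
  have := hP.dotProduct_mulVec_nonneg v
  rw [star_trivial, sub_mulVec, dotProduct_sub, Algebra.algebraMap_eq_smul_one, smul_mulVec,
    one_mulVec, dotProduct_smul, smul_eq_mul] at this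
  linarith

lemma l2_inv_mulVec_le {A : Matrix (Fin n) (Fin n) ℝ} (hA : A.PosDef) {lam : ℝ} (hlam : 0 < lam)
    (h : lam ≤ minEigenvalue A) (b : Fin n → ℝ) : l2 (A⁻¹ *ᵥ b) ≤ l2 b / lam := by
  set v := A⁻¹ *ᵥ b with hv
  have e : A *ᵥ v = b := by
    rw [hv, mulVec_mulVec, Matrix.mul_nonsing_inv _ ((Matrix.isUnit_iff_isUnit_det A).mp hA.isUnit),
      one_mulVec]
  have h1 := minEigenvalue_mul_le hA.isHermitian h v
  rw [e, ← l2_sq] at h1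
  have h2 := (le_abs_self _).trans (abs_dotProduct_le v b)
  rw [le_div_iff₀ hlam]
  rcases (l2_nonneg v).eq_or_lt with h0 | h0
  · rw [← h0, zero_mul]; exact l2_nonneg b
  · have : l2 v * (l2 v * lam) ≤ l2 v * l2 b := by nlinarith
    exact le_of_mul_le_mul_left this h0

lemma abs_dotProduct_inv_mulVec_le {A : Matrix (Fin n) (Fin n) ℝ} (hA : A.PosDef) {lam : ℝ}
    (hlam : 0 < lam) (h : lam ≤ minEigenvalue A) {a b : Fin n → ℝ} {K L : ℝ} (ha : l2 a ≤ K)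
    (hb : l2 b ≤ L) : |a ⬝ᵥ A⁻¹ *ᵥ b| ≤ K * L / lam := by
  refine (abs_dotProduct_le _ _).trans ?_
  rw [mul_div_assoc]
  exact mul_le_mul ha ((l2_inv_mulVec_le hA hlam h b).trans (by gcongr)) (l2_nonneg _)
    ((l2_nonneg a).trans ha)

/-! ### Sensitivity of the exploitation price -/

namespace NoiseAssumption

variable {ν : Measure ℝ}

/-- The exploitation price for a manipulated feature differs from the clairvoyant price by at most
a multiple of the estimation error. -/
lemma exists_exploitPrice_lipschitz (hν : NoiseAssumption ν) {Wx Wθ lamA₀ : ℝ} (hWx : 0 < Wx)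
    (hWθ : 0 < Wθ) (hlamA₀ : 0 < lamA₀) :
    ∃ Q : ℝ, 0 < Q ∧ ∀ (d : ℕ) (A : Matrix (Fin d) (Fin d) ℝ), A.PosDef →
      lamA₀ ≤ minEigenvalue A → ∀ θ₀ ∈ paramSet d Wθ, ∀ θ ∈ paramSet d Wθ, ∀ x₀ x : Fin d → ℝ,
      l2 (augment x₀) ≤ Wx →
      x = x₀ - deriv (pricing ν) (θ₀ ⬝ᵥ augment x) • (A⁻¹ *ᵥ slopePart θ₀) →
      |exploitPrice ν A θ x - pricing ν (θ₀ ⬝ᵥ augment x₀)|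
        ≤ l2 (θ - θ₀) * (Wx + Q / minEigenvalue A) := by
  obtain ⟨Lg, hLg, hLip⟩ := hν.exists_deriv_pricing_lipschitz (Wθ * Wx + Wθ * Wθ / lamA₀)
  refine ⟨3 * Wθ + Wθ * Wθ * Lg * (Wx + Wθ / lamA₀), by positivity, ?_⟩
  intro d A hA hlam θ₀ hθ₀ θ hθ x₀ x hx₀ hx
  set lam := minEigenvalue A with hlamdef
  have hl : 0 < lam := hlamA₀.trans_le hlam
  set γ₀ := deriv (pricing ν) (θ₀ ⬝ᵥ augment x) with hγ₀
  set γ := deriv (pricing ν) (θ ⬝ᵥ augment x) with hγ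
  have bγ₀ : |γ₀| ≤ 1 := hν.abs_deriv_pricing_le _
  have bθ₀ := l2_le_of_mem_paramSet hθ₀
  have bθ := l2_le_of_mem_paramSet hθ
  have bβ₀ := (l2_slopePart_le θ₀).trans bθ₀
  have bβ := (l2_slopePart_le θ).trans bθ
  have bδ := l2_slopePart_le (θ - θ₀)
  set D := l2 (θ - θ₀) with hD
  have hD0 : 0 ≤ D := l2_nonneg _
  have ux : ∀ η : Fin (d + 1) → ℝ, η ⬝ᵥ augment x =
      η ⬝ᵥ augment x₀ - γ₀ * (slopePart η ⬝ᵥ A⁻¹ *ᵥ slopePart θ₀) := by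
    intro η
    conv_lhs => rw [hx]
    rw [dotProduct_augment_sub, dotProduct_smul, smul_eq_mul]
  have key : ∀ η : Fin (d + 1) → ℝ, ∀ K, l2 η ≤ K → |η ⬝ᵥ augment x| ≤ K * (Wx + Wθ / lam) := by
    intro η K hK
    have hK0 := (l2_nonneg η).trans hK
    rw [ux η]
    have h1 : |η ⬝ᵥ augment x₀| ≤ K * Wx :=
      (abs_dotProduct_le _ _).trans (mul_le_mul hK hx₀ (l2_nonneg _) hK0)
    have h2 := abs_dotProduct_inv_mulVec_le hA hl le_rfl ((l2_slopePart_le η).trans hK) bβ₀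
    have h3 : |γ₀ * (slopePart η ⬝ᵥ A⁻¹ *ᵥ slopePart θ₀)| ≤ 1 * (K * Wθ / lam) := by
      rw [abs_mul]; exact mul_le_mul bγ₀ h2 (abs_nonneg _) zero_le_one
    refine (abs_sub _ _).trans ((add_le_add h1 h3).trans (le_of_eq ?_))
    ring
  have hdiv : Wθ / lam ≤ Wθ / lamA₀ := by gcongr
  have bu : ∀ η ∈ paramSet d Wθ, |η ⬝ᵥ augment x| ≤ Wθ * Wx + Wθ * Wθ / lamA₀ := by
    intro η hη
    refine (key η Wθ (l2_le_of_mem_paramSet hη)).trans ?_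
    rw [mul_div_assoc, ← mul_add]
    gcongr
  have hdu : |θ ⬝ᵥ augment x - θ₀ ⬝ᵥ augment x| ≤ D * (Wx + Wθ / lam) := by
    rw [← sub_dotProduct]; exact key _ _ le_rfl
  have hdγ : |γ - γ₀| ≤ Lg * (D * (Wx + Wθ / lamA₀)) := by
    refine (hLip _ _ (bu θ hθ) (bu θ₀ hθ₀)).trans ?_
    gcongr
    exact hdu.trans (by gcongr)
  set q := slopePart θ ⬝ᵥ A⁻¹ *ᵥ slopePart θ with hq
  set q₀ := slopePart θ₀ ⬝ᵥ A⁻¹ *ᵥ slopePart θ₀ with hq₀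
  have bq : |q| ≤ Wθ * Wθ / lam := abs_dotProduct_inv_mulVec_le hA hl le_rfl bβ bβ
  have bdq : |q - q₀| ≤ 2 * (D * Wθ / lam) := by
    have e : q - q₀ = slopePart (θ - θ₀) ⬝ᵥ A⁻¹ *ᵥ slopePart θ +
        slopePart θ₀ ⬝ᵥ A⁻¹ *ᵥ slopePart (θ - θ₀) := by
      rw [slopePart_sub, mulVec_sub, sub_dotProduct, dotProduct_sub]; ring
    rw [e, two_mul]
    refine (abs_add_le _ _).trans (add_le_add (abs_dotProduct_inv_mulVec_le hA hl le_rfl bδ bβ) ?_)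
    rw [mul_comm D]
    exact abs_dotProduct_inv_mulVec_le hA hl le_rfl bβ₀ bδ
  have e0 : θ₀ ⬝ᵥ augment x₀ = θ₀ ⬝ᵥ augment x + q₀ * γ₀ := by
    rw [ux θ₀]; ring
  rw [exploitPrice, e0]
  refine (hν.abs_pricing_sub_le _ _).trans ?_
  have e1 : θ ⬝ᵥ augment x + q * γ - (θ₀ ⬝ᵥ augment x + q₀ * γ₀) =
      (θ ⬝ᵥ augment x - θ₀ ⬝ᵥ augment x) + q * (γ - γ₀) + (q - q₀) * γ₀ := by ring
  rw [e1]
  have t1 : |q * (γ - γ₀)| ≤ Wθ * Wθ / lam * (Lg * (D * (Wx + Wθ / lamA₀))) := by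
    rw [abs_mul]; exact mul_le_mul bq hdγ (abs_nonneg _) (by positivity)
  have t2 : |(q - q₀) * γ₀| ≤ 2 * (D * Wθ / lam) * 1 := by
    rw [abs_mul]; exact mul_le_mul bdq bγ₀ (abs_nonneg _) (by positivity)
  refine (abs_add_three _ _ _).trans ((add_le_add_three hdu t1 t2).trans (le_of_eq ?_))
  field_simp
  ring

end NoiseAssumption

/-! ### Feature laws -/

lemma l2_augment_le_ae {Wx lam : ℝ} {P : Measure (Fin d → ℝ)} (hP : P ∈ featureLaws d Wx lam) :
    ∀ᵐ x ∂P, l2 (augment x) ≤ Wx := by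
  filter_upwards [hP.2.1] with x hx
  rwa [norm_toLp_eq_l2] at hx

lemma measurable_augment : Measurable (augment : (Fin d → ℝ) → Fin (d + 1) → ℝ) := by
  refine measurable_pi_lambda _ fun i => ?_
  refine Fin.lastCases ?_ (fun j => ?_) i
  · simp [augment]
  · simpa [augment] using measurable_pi_apply j

lemma dim_le_of_mem_featureLaws {Wx lam : ℝ} (hlam : 0 < lam) {P : Measure (Fin d → ℝ)}
    (hP : P ∈ featureLaws d Wx lam) : (d + 1 : ℝ) ≤ Wx ^ 2 / lam := by
  have := hP.1
  have hae := l2_augment_le_ae hP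
  have hint : ∀ i, Integrable (fun x : Fin d → ℝ => augment x i * augment x i) P := fun i => by
    refine Integrable.of_bound (C := Wx * Wx) ?_ ?_
    · exact (((measurable_pi_apply i).comp measurable_augment).mul
        ((measurable_pi_apply i).comp measurable_augment)).aestronglyMeasurable
    · filter_upwards [hae] with x hx
      rw [norm_mul, Real.norm_eq_abs]
      have := (abs_apply_le_l2 (augment x) i).trans hx
      exact mul_le_mul this this (abs_nonneg _) ((abs_nonneg _).trans this)
  have h1 : ∀ i, lam ≤ secondMoment P i i := fun i => by
    have := minEigenvalue_mul_le hP.2.2.1.isHermitian hP.2.2.2 (Pi.single i 1)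
    simpa using this
  have h2 : ∑ i, secondMoment P i i ≤ Wx ^ 2 := by
    simp only [secondMoment]
    rw [← integral_finsetSum _ fun i _ => hint i]
    have : ∫ x : Fin d → ℝ, ∑ i, augment x i * augment x i ∂P ≤ ∫ _, Wx ^ 2 ∂P := by
      refine integral_mono_ae (integrable_finsetSum _ fun i _ => hint i) (integrable_const _) ?_
      filter_upwards [hae] with x hx
      have := pow_le_pow_left₀ (l2_nonneg _) hx 2
      rwa [l2_sq] at this
    simpa using this
  rw [le_div_iff₀ hlam]
  have h3 := (Finset.sum_le_sum fun i (_ : i ∈ Finset.univ) => h1 i).trans h2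
  simpa using h3

/-! ### Score and information of one exploration period -/

/-- The index `u = p - θᵀ x` of a draw. -/
def drawIndex (θ : Fin (d + 1) → ℝ) (w : Draw d) : ℝ :=
  w.uniformPrice - θ ⬝ᵥ augment w.feature

/-- The sale indicator of an exploration period with true parameter `θ`. -/
noncomputable def drawOutcome (θ : Fin (d + 1) → ℝ) (w : Draw d) : Bool :=
  decide (w.uniformPrice ≤ θ ⬝ᵥ augment w.feature + w.noise)

/-- The exploration record produced by a draw. -/
noncomputable def drawRecord (θ : Fin (d + 1) → ℝ) (w : Draw d) : Record d :=
  (w.uniformPrice, w.feature, drawOutcome θ w)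

/-- Coordinate of the (negative) score at the true parameter. -/
noncomputable def drawScore (ν : Measure ℝ) (θ : Fin (d + 1) → ℝ) (i : Fin (d + 1))
    (w : Draw d) : ℝ :=
  logLikDeriv ν (drawOutcome θ w) (drawIndex θ w) * augment w.feature i

/-- Entry of the observed information matrix at the true parameter. -/
noncomputable def drawInfo (ν : Measure ℝ) (θ : Fin (d + 1) → ℝ) (i k : Fin (d + 1))
    (w : Draw d) : ℝ :=
  -logLikDeriv2 ν (drawOutcome θ w) (drawIndex θ w) * (augment w.feature i * augment w.feature k)

lemma sum_sum_mul_eq {n : ℕ} (v x : Fin n → ℝ) (a : ℝ) :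
    ∑ i, ∑ k, v i * v k * (a * (x i * x k)) = a * (v ⬝ᵥ x) ^ 2 := by
  rw [dotProduct, sq, Finset.sum_mul_sum, Finset.mul_sum]
  refine Finset.sum_congr rfl fun i _ => ?_
  rw [Finset.mul_sum]
  exact Finset.sum_congr rfl fun k _ => by ring

lemma abs_quadratic_form_le {n : ℕ} (v : Fin n → ℝ) (E : Fin n → Fin n → ℝ) {ε : ℝ} (hε : 0 ≤ ε)
    (hE : ∑ i, ∑ k, E i k ^ 2 ≤ ε ^ 2) :
    |∑ i, ∑ k, v i * v k * E i k| ≤ l2 v ^ 2 * ε := by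
  apply abs_le_of_sq_le_sq _ (by positivity)
  have h := Finset.sum_mul_sq_le_sq_mul_sq (Finset.univ ×ˢ Finset.univ)
    (fun q : Fin n × Fin n => v q.1 * v q.2) (fun q => E q.1 q.2)
  rw [Finset.sum_product, Finset.sum_product, Finset.sum_product] at h
  refine h.trans ?_
  have e : ∑ x, ∑ y, (v x * v y) ^ 2 = (l2 v ^ 2) ^ 2 := by
    rw [l2_sq, dotProduct, sq (∑ i, v i * v i), Finset.sum_mul_sum]
    exact Finset.sum_congr rfl fun i _ => Finset.sum_congr rfl fun k _ => by ring
  simp only at e ⊢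
  rw [e, mul_pow]
  gcongr

set_option maxHeartbeats 400000 in
/-- Deterministic error bound for the maximum likelihood estimate: the error is controlled by the
average score and by the deviation of the observed information from a positive definite matrix. -/
lemma l2_mle_sub_sq_le {ν : Measure ℝ} (hν : NoiseAssumption ν) {R M Wx Wθ c : ℝ} (hM : 0 < M)
    (hWx : 0 < Wx) (hWθ : 0 < Wθ) (hc : 0 < c)
    (hbound : ∀ y u, |u| ≤ R → |logLikDeriv ν y u| ≤ M ∧ |logLikDeriv2 ν y u| ≤ M ∧
      ∀ t, |t| ≤ 1 → |logLik ν y (u - t) -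
        (logLik ν y u - logLikDeriv ν y u * t + logLikDeriv2 ν y u * t ^ 2 / 2)| ≤ M * |t| ^ 3) :
    ∃ C : ℝ, 0 < C ∧ ∀ (d n : ℕ), 0 < n → ∀ θ₀ ∈ paramSet d Wθ, ∀ θ ∈ paramSet d Wθ,
      ∀ (w : Fin n → Draw d), (∀ j, l2 (augment (w j).feature) ≤ Wx) →
      (∀ j, |drawIndex θ₀ (w j)| ≤ R) →
      logLikelihood ν n (fun j => drawRecord θ₀ (w j)) θ₀ ≤
        logLikelihood ν n (fun j => drawRecord θ₀ (w j)) θ →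
      ∀ H : Fin (d + 1) → Fin (d + 1) → ℝ,
      (∀ v : Fin (d + 1) → ℝ, c * (v ⬝ᵥ v) ≤ ∑ i, ∑ k, v i * v k * H i k) →
      l2 (θ - θ₀) ^ 2 ≤ C * (∑ i, (1 / (n : ℝ) * ∑ j, drawScore ν θ₀ i (w j)) ^ 2 +
        ∑ i, ∑ k, (1 / (n : ℝ) * ∑ j, drawInfo ν θ₀ i k (w j) - H i k) ^ 2) := by
  obtain ⟨s, hs, hs1, hs2, hs3⟩ : ∃ s : ℝ, 0 < s ∧ s ≤ 1 ∧ s * (2 * Wθ * Wx) ≤ 1 ∧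
      M * s * (2 * Wθ * Wx) * Wx ^ 2 ≤ c / 8 := by
    have hp : 0 < 1 + 2 * Wθ * Wx + 16 * M * Wθ * Wx ^ 3 / c := by positivity
    have hq : 0 ≤ 2 * Wθ * Wx := by positivity
    have hr : 0 ≤ 16 * M * Wθ * Wx ^ 3 / c := by positivity
    refine ⟨(1 + 2 * Wθ * Wx + 16 * M * Wθ * Wx ^ 3 / c)⁻¹, by positivity, ?_, ?_, ?_⟩
    · exact inv_le_one_of_one_le₀ (by linarith)
    · rw [inv_mul_le_iff₀ hp]; linarith
    · have : (1 + 2 * Wθ * Wx + 16 * M * Wθ * Wx ^ 3 / c)⁻¹ * (16 * M * Wθ * Wx ^ 3 / c) ≤ 1 := by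
        rw [inv_mul_le_iff₀ hp]; linarith
      have h2 := mul_le_mul_of_nonneg_left this (by positivity : 0 ≤ c / 8)
      refine le_trans (le_of_eq ?_) (h2.trans (by rw [mul_one]))
      field_simp
      ring
  refine ⟨64 / (c ^ 2 * s ^ 2) + 16 * Wθ ^ 2 / c ^ 2, by positivity, ?_⟩
  intro d n hn θ₀ hθ₀ θ hθ w hx hu hmle H hH
  set δ := θ - θ₀ with hδ
  have bD : l2 δ ≤ 2 * Wθ := (l2_sub_le _ _).trans
    (by linarith [l2_le_of_mem_paramSet hθ, l2_le_of_mem_paramSet hθ₀])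
  have hD0 := l2_nonneg δ
  set D := l2 δ with hD
  set S : Fin (d + 1) → ℝ := fun i => 1 / (n : ℝ) * ∑ j, drawScore ν θ₀ i (w j) with hS
  set E : Fin (d + 1) → Fin (d + 1) → ℝ :=
    fun i k => 1 / (n : ℝ) * ∑ j, drawInfo ν θ₀ i k (w j) - H i k with hE
  have hS0 : 0 ≤ ∑ i, S i ^ 2 := Finset.sum_nonneg fun i _ => sq_nonneg _
  have hE0 : 0 ≤ ∑ i, ∑ k, E i k ^ 2 :=
    Finset.sum_nonneg fun i _ => Finset.sum_nonneg fun k _ => sq_nonneg _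
  change D ^ 2 ≤ _ * (∑ i, S i ^ 2 + ∑ i, ∑ k, E i k ^ 2)
  by_cases hcase : ∑ i, ∑ k, E i k ^ 2 ≤ (c / 2) ^ 2
  swap
  · push Not at hcase
    have h1 : D ^ 2 ≤ (2 * Wθ) ^ 2 := pow_le_pow_left₀ hD0 bD 2
    have h2 : (2 * Wθ) ^ 2 = 16 * Wθ ^ 2 / c ^ 2 * (c / 2) ^ 2 := by field_simp; ring
    have h3 : 16 * Wθ ^ 2 / c ^ 2 * (c / 2) ^ 2 ≤ 16 * Wθ ^ 2 / c ^ 2 * ∑ i, ∑ k, E i k ^ 2 := by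
      gcongr
    have h4 : 0 ≤ 64 / (c ^ 2 * s ^ 2) * (∑ i, S i ^ 2 + ∑ i, ∑ k, E i k ^ 2) := by positivity
    have h5 : 0 ≤ 16 * Wθ ^ 2 / c ^ 2 * ∑ i, S i ^ 2 := by positivity
    rw [add_mul, mul_add (16 * _ / _)]
    linarith
  have hnR : (0 : ℝ) < n := by exact_mod_cast hn
  -- the quadratic form of the observed information
  have hquad : c / 2 * D ^ 2 ≤
      1 / (n : ℝ) * ∑ j, -logLikDeriv2 ν (drawOutcome θ₀ (w j)) (drawIndex θ₀ (w j)) *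
        (δ ⬝ᵥ augment (w j).feature) ^ 2 := by
    have e : 1 / (n : ℝ) * ∑ j, -logLikDeriv2 ν (drawOutcome θ₀ (w j)) (drawIndex θ₀ (w j)) *
        (δ ⬝ᵥ augment (w j).feature) ^ 2 =
        ∑ i, ∑ k, δ i * δ k * E i k + ∑ i, ∑ k, δ i * δ k * H i k := by
      rw [← Finset.sum_add_distrib]
      simp_rw [← Finset.sum_add_distrib, ← sum_sum_mul_eq, hE, ← mul_add, sub_add_cancel,
        Finset.mul_sum]
      rw [Finset.sum_comm]
      refine Finset.sum_congr rfl fun i _ => ?_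
      rw [Finset.sum_comm]
      refine Finset.sum_congr rfl fun k _ => Finset.sum_congr rfl fun j _ => ?_
      rw [drawInfo]; ring
    have h1 := (abs_le.mp (abs_quadratic_form_le δ E (by positivity) hcase)).1
    have h2 := hH δ
    rw [← l2_sq] at h2
    rw [e]
    linarith
  have hlin : 1 / (n : ℝ) * ∑ j, logLikDeriv ν (drawOutcome θ₀ (w j)) (drawIndex θ₀ (w j)) *
        (δ ⬝ᵥ augment (w j).feature) = δ ⬝ᵥ S := by
    simp_rw [hS, dotProduct, Finset.mul_sum]
    rw [Finset.sum_comm]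
    refine Finset.sum_congr rfl fun i _ => Finset.sum_congr rfl fun j _ => ?_
    rw [drawScore]; ring
  -- pointwise expansion along the segment from `θ₀` to the estimate
  have hpt : ∀ j, s * (logLik ν (drawOutcome θ₀ (w j))
        (drawIndex θ₀ (w j) - δ ⬝ᵥ augment (w j).feature)
        - logLik ν (drawOutcome θ₀ (w j)) (drawIndex θ₀ (w j))) ≤
      -s * (logLikDeriv ν (drawOutcome θ₀ (w j)) (drawIndex θ₀ (w j)) *
        (δ ⬝ᵥ augment (w j).feature)) - s ^ 2 / 2 *
        (-logLikDeriv2 ν (drawOutcome θ₀ (w j)) (drawIndex θ₀ (w j)) *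
          (δ ⬝ᵥ augment (w j).feature) ^ 2) + s ^ 2 * (c / 8 * D ^ 2) := by
    intro j
    set y := drawOutcome θ₀ (w j)
    set u := drawIndex θ₀ (w j)
    set t := δ ⬝ᵥ augment (w j).feature
    have ht : |t| ≤ D * Wx := (abs_dotProduct_le _ _).trans (by gcongr; exact hx j)
    have ht' : |t| ≤ 2 * Wθ * Wx := ht.trans (by gcongr)
    have hst : |s * t| ≤ 1 := by
      rw [abs_mul, abs_of_pos hs]
      exact (mul_le_mul_of_nonneg_left ht' hs.le).trans hs2
    have hconc := (hν.concaveOn_logLik y).2 (mem_univ u) (mem_univ (u - t)) (sub_nonneg.mpr hs1)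
      hs.le (by ring)
    simp only [smul_eq_mul] at hconc
    rw [show (1 - s) * u + s * (u - t) = u - s * t by ring] at hconc
    have htay := (abs_le.mp ((hbound y u (hu j)).2.2 (s * t) hst)).2
    have hcub : M * |s * t| ^ 3 ≤ s ^ 2 * (c / 8 * D ^ 2) := by
      have h1 : |t| ^ 3 ≤ (2 * Wθ * Wx) * (D * Wx) ^ 2 := by
        rw [pow_succ' |t| 2]
        gcongr
      calc M * |s * t| ^ 3 = M * s ^ 3 * |t| ^ 3 := by rw [abs_mul, abs_of_pos hs]; ring
        _ ≤ M * s ^ 3 * ((2 * Wθ * Wx) * (D * Wx) ^ 2) := by gcongr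
        _ = s ^ 2 * ((M * s * (2 * Wθ * Wx) * Wx ^ 2) * D ^ 2) := by ring
        _ ≤ s ^ 2 * (c / 8 * D ^ 2) := by gcongr
    nlinarith
  have hdiff : ∀ j, logLik ν (drawOutcome θ₀ (w j)) (drawIndex θ (w j)) =
      logLik ν (drawOutcome θ₀ (w j)) (drawIndex θ₀ (w j) - δ ⬝ᵥ augment (w j).feature) := by
    intro j
    congr 1
    simp only [drawIndex, hδ, sub_dotProduct]
    ring
  have hmle' : 0 ≤ 1 / (n : ℝ) * ∑ j, s * (logLik ν (drawOutcome θ₀ (w j))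
        (drawIndex θ₀ (w j) - δ ⬝ᵥ augment (w j).feature)
        - logLik ν (drawOutcome θ₀ (w j)) (drawIndex θ₀ (w j))) := by
    rw [← Finset.mul_sum, Finset.sum_sub_distrib, mul_left_comm, mul_sub]
    refine mul_nonneg hs.le (sub_nonneg.mpr ?_)
    refine hmle.trans (le_of_eq ?_)
    rw [logLikelihood]
    congr 1
    exact Finset.sum_congr rfl fun j _ => hdiff j
  have h6 := hmle'.trans (mul_le_mul_of_nonneg_left
    (Finset.sum_le_sum fun j (_ : j ∈ Finset.univ) => hpt j) (by positivity : (0 : ℝ) ≤ 1 / (n : ℝ)))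
  rw [Finset.sum_add_distrib, Finset.sum_sub_distrib, ← Finset.mul_sum, ← Finset.mul_sum, mul_add,
    mul_sub, mul_left_comm _ (-s), mul_left_comm _ (s ^ 2 / 2), hlin, Finset.sum_const,
    Finset.card_univ, Fintype.card_fin, nsmul_eq_mul, one_div_mul_eq_div (n : ℝ) (_ * _),
    mul_div_cancel_left₀ _ hnR.ne'] at h6
  have hSn : l2 S ^ 2 = ∑ i, S i ^ 2 := by
    rw [l2_sq, dotProduct]; exact Finset.sum_congr rfl fun i _ => by ring
  have h7 : -(δ ⬝ᵥ S) ≤ D * l2 S := (neg_le_abs _).trans (abs_dotProduct_le _ _)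
  have h8 : s ^ 2 * (c / 8) * D ^ 2 ≤ s * (D * l2 S) := by
    have q1 := mul_le_mul_of_nonneg_left hquad (by positivity : 0 ≤ s ^ 2 / 2)
    have q2 := mul_le_mul_of_nonneg_left h7 hs.le
    linarith
  have h9 : D * (s * c) ≤ 8 * l2 S := by
    rcases hD0.eq_or_lt with h0 | h0
    · rw [← h0, zero_mul]; have := l2_nonneg S; positivity
    · refine le_of_mul_le_mul_left ?_ (mul_pos hs h0)
      linarith
  have h10 : D ^ 2 ≤ 64 / (c ^ 2 * s ^ 2) * ∑ i, S i ^ 2 := by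
    rw [← hSn, div_mul_eq_mul_div, le_div_iff₀ (by positivity)]
    have := pow_le_pow_left₀ (by positivity) h9 2
    linarith
  have h11 : 0 ≤ 16 * Wθ ^ 2 / c ^ 2 * (∑ i, S i ^ 2 + ∑ i, ∑ k, E i k ^ 2) := by positivity
  have h12 : 0 ≤ 64 / (c ^ 2 * s ^ 2) * ∑ i, ∑ k, E i k ^ 2 := by positivity
  rw [add_mul, mul_add (64 / _)]
  linarith

variable {ν : Measure ℝ}

/-! ### The law of one draw -/

lemma isProbabilityMeasure_uniform {B : ℝ} (hB : 0 < B) :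
    IsProbabilityMeasure ((volume : Measure ℝ)[|Ioo 0 B]) :=
  cond_isProbabilityMeasure_of_finite (by simp [hB]) (by simp)

lemma isProbabilityMeasure_drawLaw (hν : NoiseAssumption ν) {B : ℝ} (hB : 0 < B)
    (P : Measure (Fin d → ℝ)) [IsProbabilityMeasure P] : IsProbabilityMeasure (drawLaw ν B P) := by
  have := hν.isProbabilityMeasure
  have := isProbabilityMeasure_uniform hB
  unfold drawLaw
  infer_instance

lemma uniform_mem_ae {B : ℝ} (_hB : 0 < B) :
    ∀ᵐ p ∂((volume : Measure ℝ)[|Ioo 0 B]), p ∈ Ioo 0 B :=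
  ae_cond_mem measurableSet_Ioo

lemma drawLaw_support (hν : NoiseAssumption ν) {B Wx lam : ℝ} (hB : 0 < B)
    {P : Measure (Fin d → ℝ)} (hP : P ∈ featureLaws d Wx lam) :
    ∀ᵐ w ∂(drawLaw ν B P), l2 (augment (Draw.feature w)) ≤ Wx ∧ Draw.uniformPrice w ∈ Ioo 0 B := by
  have := hP.1
  have := hν.isProbabilityMeasure
  have := isProbabilityMeasure_uniform hB
  have h1 : ∀ᵐ w ∂(drawLaw ν B P), l2 (augment (Draw.feature w)) ≤ Wx :=
    Measure.quasiMeasurePreserving_fst.ae (l2_augment_le_ae hP)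
  have h2 : ∀ᵐ w ∂(drawLaw ν B P), Draw.uniformPrice w ∈ Ioo 0 B :=
    Measure.quasiMeasurePreserving_snd.ae
      (Measure.quasiMeasurePreserving_snd.ae (uniform_mem_ae hB))
  filter_upwards [h1, h2] with w a b using ⟨a, b⟩

lemma measurable_feature : Measurable (Draw.feature : Draw d → _) := measurable_fst

lemma measurable_noise : Measurable (Draw.noise : Draw d → ℝ) := measurable_fst.comp measurable_snd

lemma measurable_uniformPrice : Measurable (Draw.uniformPrice : Draw d → ℝ) :=
  measurable_snd.comp measurable_snd

lemma measurable_dotProduct_const {n : ℕ} (θ : Fin n → ℝ) :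
    Measurable (fun x : Fin n → ℝ => θ ⬝ᵥ x) := by
  unfold dotProduct
  fun_prop

lemma measurable_drawIndex (θ : Fin (d + 1) → ℝ) : Measurable (drawIndex θ) :=
  measurable_uniformPrice.sub ((measurable_dotProduct_const θ).comp
    (measurable_augment.comp measurable_feature))

lemma measurable_drawOutcome (θ : Fin (d + 1) → ℝ) : Measurable (drawOutcome θ) := by
  refine measurable_to_bool ?_
  have : drawOutcome θ ⁻¹' {true} =
      {w | Draw.uniformPrice w ≤ θ ⬝ᵥ augment w.feature + w.noise} := by
    ext w; simp [drawOutcome]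
  rw [this]
  exact measurableSet_le measurable_uniformPrice (((measurable_dotProduct_const θ).comp
    (measurable_augment.comp measurable_feature)).add measurable_noise)

lemma measurable_drawRecord (θ : Fin (d + 1) → ℝ) : Measurable (drawRecord θ) :=
  measurable_uniformPrice.prodMk (measurable_feature.prodMk (measurable_drawOutcome θ))

lemma measurable_bool_family {h : Bool → ℝ → ℝ} (hh : ∀ y, Continuous (h y)) :
    Measurable (fun q : Bool × ℝ => h q.1 q.2) :=
  measurable_from_prod_countable_right fun y => (hh y).measurable

lemma measurable_drawScore (hν : NoiseAssumption ν) (θ : Fin (d + 1) → ℝ) (i : Fin (d + 1)) :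
    Measurable (drawScore ν θ i) :=
  ((measurable_bool_family hν.continuous_logLikDeriv).comp
    ((measurable_drawOutcome θ).prodMk (measurable_drawIndex θ))).mul
    ((measurable_pi_apply i).comp (measurable_augment.comp measurable_feature))

lemma measurable_drawInfo (hν : NoiseAssumption ν) (θ : Fin (d + 1) → ℝ) (i k : Fin (d + 1)) :
    Measurable (drawInfo ν θ i k) :=
  ((measurable_bool_family hν.continuous_logLikDeriv2).comp
    ((measurable_drawOutcome θ).prodMk (measurable_drawIndex θ))).neg.mul
    (((measurable_pi_apply i).comp (measurable_augment.comp measurable_feature)).mul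
    ((measurable_pi_apply k).comp (measurable_augment.comp measurable_feature)))

lemma NoiseAssumption.measureReal_Iio (hν : NoiseAssumption ν) (c : ℝ) :
    ν.real (Iio c) = noiseCDF ν c := by
  have := hν.isProbabilityMeasure
  have h0 : ν {c} = 0 := by
    have h := (cdf ν).measure_singleton c
    rw [measure_cdf] at h
    have hc : ContinuousAt (cdf ν : ℝ → ℝ) c := hν.continuous_cdf.continuousAt
    rw [h, leftLim_eq_of_tendsto (hc.tendsto.mono_left nhdsWithin_le_nhds)]
    simp
  rw [noiseCDF, cdf_eq_real, Measure.real, Measure.real, ← Iio_union_right]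
  congr 1
  exact (measure_congr (union_ae_eq_left_of_ae_eq_empty (ae_eq_empty.mpr h0))).symm

lemma NoiseAssumption.integral_threshold (hν : NoiseAssumption ν) (c a b : ℝ) :
    ∫ z, (if c ≤ z then a else b) ∂ν = (1 - noiseCDF ν c) * a + noiseCDF ν c * b := by
  have := hν.isProbabilityMeasure
  have e : (fun z => if c ≤ z then a else b) =
      fun z => (Iio c).indicator (fun _ => b - a) z + a := by
    ext z
    by_cases h : c ≤ z
    · simp [h]
    · simp [h, not_le.mp h]
  rw [e, integral_add ((integrable_const _).indicator measurableSet_Iio) (integrable_const _),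
    integral_indicator_const _ measurableSet_Iio, hν.measureReal_Iio]
  simp
  ring

/-- Expectation over one draw of a function of the price, the feature and the sale indicator. -/
lemma integral_drawLaw_outcome (hν : NoiseAssumption ν) {B : ℝ} (hB : 0 < B)
    (P : Measure (Fin d → ℝ)) [IsProbabilityMeasure P] (θ : Fin (d + 1) → ℝ)
    (Ψ : Bool → ℝ → (Fin d → ℝ) → ℝ)
    (hΨ : Integrable (fun w : Draw d => Ψ (drawOutcome θ w) w.uniformPrice w.feature)
      (drawLaw ν B P)) :
    ∫ w, Ψ (drawOutcome θ w) w.uniformPrice w.feature ∂(drawLaw ν B P) =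
      ∫ x, ∫ p, ((1 - noiseCDF ν (p - θ ⬝ᵥ augment x)) * Ψ true p x +
        noiseCDF ν (p - θ ⬝ᵥ augment x) * Ψ false p x) ∂(volume[|Ioo 0 B]) ∂P := by
  have := hν.isProbabilityMeasure
  have := isProbabilityMeasure_uniform hB
  unfold drawLaw at hΨ ⊢
  rw [integral_prod _ hΨ]
  refine integral_congr_ae ?_
  filter_upwards [hΨ.prod_right_ae] with x hx
  rw [integral_prod_symm _ hx]
  refine integral_congr_ae (Filter.Eventually.of_forall fun p => ?_)
  simp only
  rw [← hν.integral_threshold]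
  refine integral_congr_ae (Filter.Eventually.of_forall fun z => ?_)
  simp only [drawOutcome]
  by_cases h : p ≤ θ ⬝ᵥ augment x + z
  · have h' : p - θ ⬝ᵥ augment x ≤ z := by linarith
    simp [h, h']
  · have h' : ¬ p - θ ⬝ᵥ augment x ≤ z := fun h' => h (by linarith)
    simp [h, h']

lemma abs_drawIndex_le {B Wx Wθ : ℝ} {θ : Fin (d + 1) → ℝ} (hθ : θ ∈ paramSet d Wθ) {w : Draw d}
    (hx : l2 (augment w.feature) ≤ Wx) (hp : w.uniformPrice ∈ Ioo 0 B) :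
    |drawIndex θ w| ≤ B + Wθ * Wx := by
  have h2 := l2_le_of_mem_paramSet hθ
  have h1 : |θ ⬝ᵥ augment w.feature| ≤ Wθ * Wx := (abs_dotProduct_le _ _).trans
    (mul_le_mul h2 hx (l2_nonneg _) ((l2_nonneg _).trans h2))
  refine (abs_sub _ _).trans (add_le_add ?_ h1)
  rw [abs_of_pos hp.1]; exact hp.2.le

lemma abs_drawScore_le {M R Wx : ℝ} (hb : ∀ y u, |u| ≤ R → |logLikDeriv ν y u| ≤ M)
    {θ : Fin (d + 1) → ℝ} {w : Draw d} (hx : l2 (augment w.feature) ≤ Wx)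
    (hu : |drawIndex θ w| ≤ R) (i : Fin (d + 1)) : |drawScore ν θ i w| ≤ M * Wx := by
  rw [drawScore, abs_mul]
  have h1 := hb (drawOutcome θ w) _ hu
  exact mul_le_mul h1 ((abs_apply_le_l2 _ i).trans hx) (abs_nonneg _) ((abs_nonneg _).trans h1)

lemma abs_drawInfo_le {M R Wx : ℝ} (hb : ∀ y u, |u| ≤ R → |logLikDeriv2 ν y u| ≤ M)
    {θ : Fin (d + 1) → ℝ} {w : Draw d} (hx : l2 (augment w.feature) ≤ Wx)
    (hu : |drawIndex θ w| ≤ R) (i k : Fin (d + 1)) : |drawInfo ν θ i k w| ≤ M * Wx ^ 2 := by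
  rw [drawInfo, abs_mul, abs_neg, abs_mul, sq]
  have h1 := hb (drawOutcome θ w) _ hu
  have h2 := fun i => (abs_apply_le_l2 (augment w.feature) i).trans hx
  exact mul_le_mul h1 (mul_le_mul (h2 i) (h2 k) (abs_nonneg _) ((abs_nonneg _).trans (h2 i)))
    (by positivity) ((abs_nonneg _).trans h1)

/-- The score has mean zero. -/
lemma integral_drawScore (hν : NoiseAssumption ν) {B : ℝ} (hB : 0 < B)
    (P : Measure (Fin d → ℝ)) [IsProbabilityMeasure P] (θ : Fin (d + 1) → ℝ) (i : Fin (d + 1))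
    (hint : Integrable (drawScore ν θ i) (drawLaw ν B P)) :
    ∫ w, drawScore ν θ i w ∂(drawLaw ν B P) = 0 := by
  refine (integral_drawLaw_outcome hν hB P θ
    (fun y p x => logLikDeriv ν y (p - θ ⬝ᵥ augment x) * augment x i) hint).trans ?_
  have : ∀ x p, (1 - noiseCDF ν (p - θ ⬝ᵥ augment x)) *
        (logLikDeriv ν true (p - θ ⬝ᵥ augment x) * augment x i) +
      noiseCDF ν (p - θ ⬝ᵥ augment x) *
        (logLikDeriv ν false (p - θ ⬝ᵥ augment x) * augment x i) = 0 := fun x p => by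
    rw [← mul_assoc, ← mul_assoc, ← add_mul, hν.mean_logLikDeriv, zero_mul]
  simp [this]

/-- The Fisher information matrix is bounded below by a multiple of the second moment matrix. -/
lemma fisher_lower_bound (hν : NoiseAssumption ν) {B Wx Wθ lam c : ℝ} (hB : 0 < B)
    (hc0 : 0 < c)
    {P : Measure (Fin d → ℝ)} (hP : P ∈ featureLaws d Wx lam) {θ : Fin (d + 1) → ℝ}
    (hθ : θ ∈ paramSet d Wθ) (hc : ∀ u, |u| ≤ B + Wθ * Wx → c ≤ noisePDF ν u)
    (hint : ∀ i k, Integrable (drawInfo ν θ i k) (drawLaw ν B P)) (v : Fin (d + 1) → ℝ) :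
    c ^ 2 * lam * (v ⬝ᵥ v) ≤ ∑ i, ∑ k, v i * v k * ∫ w, drawInfo ν θ i k w ∂(drawLaw ν B P) := by
  have := hP.1
  have := hν.isProbabilityMeasure
  have := isProbabilityMeasure_uniform hB
  have := isProbabilityMeasure_drawLaw hν hB P
  have hae := l2_augment_le_ae hP
  have hS : lam * (v ⬝ᵥ v) ≤ ∫ x, (v ⬝ᵥ augment x) ^ 2 ∂P := by
    refine (minEigenvalue_mul_le hP.2.2.1.isHermitian hP.2.2.2 v).trans (le_of_eq ?_)
    have hi : ∀ i k, Integrable (fun x => augment x i * augment x k) P := fun i k => by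
      refine Integrable.of_bound (C := Wx * Wx) ?_ ?_
      · exact (((measurable_pi_apply i).comp measurable_augment).mul
          ((measurable_pi_apply k).comp measurable_augment)).aestronglyMeasurable
      · filter_upwards [hae] with x hx
        have h := fun i => (abs_apply_le_l2 (augment x) i).trans hx
        rw [norm_mul, Real.norm_eq_abs, Real.norm_eq_abs]
        exact mul_le_mul (h i) (h k) (abs_nonneg _) ((abs_nonneg _).trans (h i))
    have e : ∀ x : Fin d → ℝ, (v ⬝ᵥ augment x) ^ 2 =
        ∑ i, ∑ k, v i * v k * (augment x i * augment x k) := fun x => by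
      have := sum_sum_mul_eq v (augment x) 1
      simp only [one_mul] at this
      exact this.symm
    simp_rw [e]
    rw [integral_finsetSum _ fun i _ => integrable_finsetSum _ fun k _ => (hi i k).const_mul _]
    rw [dotProduct]
    refine Finset.sum_congr rfl fun i _ => ?_
    rw [integral_finsetSum _ fun k _ => (hi i k).const_mul _, mulVec, dotProduct, Finset.mul_sum]
    refine Finset.sum_congr rfl fun k _ => ?_
    rw [integral_const_mul, secondMoment]
    ring
  have hI : ∑ i, ∑ k, v i * v k * ∫ w, drawInfo ν θ i k w ∂(drawLaw ν B P) =
      ∫ w, -logLikDeriv2 ν (drawOutcome θ w) (drawIndex θ w) * (v ⬝ᵥ augment w.feature) ^ 2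
        ∂(drawLaw ν B P) := by
    have e : ∀ w, -logLikDeriv2 ν (drawOutcome θ w) (drawIndex θ w) *
        (v ⬝ᵥ augment w.feature) ^ 2 = ∑ i, ∑ k, v i * v k * drawInfo ν θ i k w :=
      fun w => (sum_sum_mul_eq _ _ _).symm
    simp_rw [e]
    rw [integral_finsetSum _ fun i _ => integrable_finsetSum _ fun k _ => (hint i k).const_mul _]
    refine Finset.sum_congr rfl fun i _ => ?_
    rw [integral_finsetSum _ fun k _ => (hint i k).const_mul _]
    exact Finset.sum_congr rfl fun k _ => (integral_const_mul _ _).symm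
  have hint2 : Integrable (fun w : Draw d => -logLikDeriv2 ν (drawOutcome θ w) (drawIndex θ w) *
      (v ⬝ᵥ augment w.feature) ^ 2) (drawLaw ν B P) := by
    simp_rw [← sum_sum_mul_eq]
    exact integrable_finsetSum _ fun i _ => integrable_finsetSum _ fun k _ =>
      (hint i k).const_mul _
  rw [hI]
  have hsq : Integrable (fun w : Draw d => c ^ 2 * (v ⬝ᵥ augment w.feature) ^ 2)
      (drawLaw ν B P) := by
    refine Integrable.of_bound (C := c ^ 2 * (l2 v * Wx) ^ 2) ?_ ?_
    · exact (((((measurable_dotProduct_const v).comp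
        (measurable_augment.comp measurable_feature)).pow_const 2).const_mul _)).aestronglyMeasurable
    · filter_upwards [drawLaw_support hν hB hP] with w hw
      rw [Real.norm_eq_abs, abs_mul, abs_of_nonneg (sq_nonneg c), abs_pow]
      have := (abs_dotProduct_le v (augment w.feature)).trans
        (mul_le_mul_of_nonneg_left hw.1 (l2_nonneg v))
      gcongr
  have e1 := integral_drawLaw_outcome hν hB P θ
    (fun y p x => -logLikDeriv2 ν y (p - θ ⬝ᵥ augment x) * (v ⬝ᵥ augment x) ^ 2
      - c ^ 2 * (v ⬝ᵥ augment x) ^ 2) (hint2.sub hsq)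
  have e2 : ∫ w, (c ^ 2 * (v ⬝ᵥ augment (Draw.feature w)) ^ 2) ∂(drawLaw ν B P) =
      c ^ 2 * ∫ x, (v ⬝ᵥ augment x) ^ 2 ∂P := by
    rw [integral_const_mul]
    congr 1
    have := integral_fun_fst (μ := P) (ν := ν.prod (volume[|Ioo 0 B]))
      (fun x => (v ⬝ᵥ augment x) ^ 2)
    exact this.trans (by simp)
  have h3 : 0 ≤ ∫ w, (-logLikDeriv2 ν (drawOutcome θ w) (drawIndex θ w) *
      (v ⬝ᵥ augment w.feature) ^ 2 - c ^ 2 * (v ⬝ᵥ augment w.feature) ^ 2) ∂(drawLaw ν B P) := by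
    refine le_of_le_of_eq ?_ e1.symm
    refine integral_nonneg_of_ae ?_
    filter_upwards [hae] with x hx
    refine integral_nonneg_of_ae ?_
    filter_upwards [uniform_mem_ae hB] with p hp
    have hu : |p - θ ⬝ᵥ augment x| ≤ B + Wθ * Wx :=
      abs_drawIndex_le (w := (x, 0, p)) hθ hx hp
    have h4 := hν.mean_logLikDeriv2_le (p - θ ⬝ᵥ augment x)
    have h5 := pow_le_pow_left₀ hc0.le (hc _ hu) 2
    have h6 : 0 ≤ (v ⬝ᵥ augment x) ^ 2 := sq_nonneg _
    simp only [Pi.zero_apply]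
    nlinarith
  rw [integral_sub hint2 hsq, e2] at h3
  have h7 := mul_le_mul_of_nonneg_left hS (sq_nonneg c)
  linarith

/-! ### Sample means -/

/-- Mean squared error of a sample mean of bounded independent variables. -/
lemma integral_sampleMean_sub_sq_le {X : Type*} [MeasurableSpace X] (μ : Measure X)
    [IsProbabilityMeasure μ] {ψ : X → ℝ} (hψ : Measurable ψ) {M : ℝ} (hM : ∀ᵐ x ∂μ, |ψ x| ≤ M)
    (ℓ : ℕ) {n : ℕ} (hn : 0 < n) :
    Integrable (fun ω : ℕ → X => (1 / (n : ℝ) * ∑ j : Fin n, ψ (ω (ℓ + j)) - ∫ x, ψ x ∂μ) ^ 2)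
      (Measure.infinitePi fun _ => μ) ∧
    ∫ ω, (1 / (n : ℝ) * ∑ j : Fin n, ψ (ω (ℓ + j)) - ∫ x, ψ x ∂μ) ^ 2
      ∂(Measure.infinitePi fun _ : ℕ => μ) ≤ M ^ 2 / n := by
  have hnR : (0 : ℝ) < n := by exact_mod_cast hn
  set π : Measure (ℕ → X) := Measure.infinitePi fun _ => μ
  have hmp : ∀ i, MeasurePreserving (Function.eval i) π μ := fun i =>
    measurePreserving_eval_infinitePi (fun _ => μ) i
  set Y : Fin n → (ℕ → X) → ℝ := fun j ω => ψ (ω (ℓ + j)) with hY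
  have hYm : ∀ j, Measurable (Y j) := fun j => hψ.comp (measurable_pi_apply _)
  have hYb : ∀ j, ∀ᵐ ω ∂π, |Y j ω| ≤ M := fun j =>
    (hmp (ℓ + j)).quasiMeasurePreserving.ae hM
  have hYL : ∀ j, MemLp (Y j) 2 π := fun j =>
    MemLp.of_bound (hYm j).aestronglyMeasurable M (hYb j)
  have hYe : ∀ j, ∫ ω, Y j ω ∂π = ∫ x, ψ x ∂μ := fun j => by
    have := (hmp (ℓ + j)).map_eq
    rw [← this, integral_map (measurable_pi_apply _).aemeasurable hψ.aestronglyMeasurable]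
  have hind : Set.Pairwise (Finset.univ : Finset (Fin n)) fun i j => Y i ⟂ᵢ[π] Y j := by
    intro i _ j _ hij
    have h := iIndepFun_infinitePi (P := fun _ : ℕ => μ) (X := fun _ => ψ) fun _ => hψ
    exact h.indepFun (fun h => hij (Fin.ext (by omega)))
  have hvar : Var[∑ j, Y j; π] ≤ n * M ^ 2 := by
    rw [IndepFun.variance_sum (fun j _ => hYL j) hind]
    have : ∀ j ∈ (Finset.univ : Finset (Fin n)), Var[Y j; π] ≤ M ^ 2 := fun j _ => by
      refine (variance_le_expectation_sq (hYm j).aestronglyMeasurable).trans ?_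
      have : ∫ ω, (Y j ω) ^ 2 ∂π ≤ ∫ _, M ^ 2 ∂π := by
        refine integral_mono_ae (hYL j).integrable_sq (integrable_const _) ?_
        filter_upwards [hYb j] with ω hω
        rw [← sq_abs]
        exact pow_le_pow_left₀ (abs_nonneg _) hω 2
      simpa using this
    simpa using Finset.sum_le_sum this
  have hSL : MemLp (∑ j, Y j) 2 π := memLp_finsetSum' _ fun j _ => hYL j
  have hmean : ∫ ω, (∑ j, Y j) ω ∂π = n * ∫ x, ψ x ∂μ := by
    simp only [Finset.sum_apply]
    rw [integral_finsetSum _ fun j _ => (hYL j).integrable one_le_two]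
    simp [hYe]
  have e : ∀ ω : ℕ → X, (1 / (n : ℝ) * ∑ j : Fin n, ψ (ω (ℓ + j)) - ∫ x, ψ x ∂μ) ^ 2 =
      1 / (n : ℝ) ^ 2 * ((∑ j, Y j) ω - ∫ ω, (∑ j, Y j) ω ∂π) ^ 2 := fun ω => by
    rw [hmean, Finset.sum_apply]
    field_simp
    rfl
  simp_rw [e]
  constructor
  · exact ((hSL.sub (memLp_const _)).integrable_sq).const_mul _
  · rw [integral_const_mul, ← variance_eq_integral hSL.1.aemeasurable]
    calc _ ≤ 1 / (n : ℝ) ^ 2 * (n * M ^ 2) := by gcongr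
      _ = M ^ 2 / n := by field_simp

/-! ### Mean squared error of the maximum likelihood estimate -/

lemma sampleLaw_support (hν : NoiseAssumption ν) {B Wx lam : ℝ} (hB : 0 < B)
    {P : Measure (Fin d → ℝ)} (hP : P ∈ featureLaws d Wx lam) :
    ∀ᵐ ω ∂(sampleLaw ν B P), ∀ t,
      l2 (augment (ω t).feature) ≤ Wx ∧ (ω t).uniformPrice ∈ Ioo 0 B := by
  have := hP.1
  have := isProbabilityMeasure_drawLaw hν hB P
  rw [ae_all_iff]
  intro t
  exact (measurePreserving_eval_infinitePi (fun _ => drawLaw ν B P) t).quasiMeasurePreserving.ae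
    (drawLaw_support hν hB hP)

lemma measurable_est {Wθ : ℝ} {est : Estimator d} (hest : IsMLE ν Wθ est) (θ₀ : Fin (d + 1) → ℝ)
    (ℓ n : ℕ) : Measurable fun ω : ℕ → Draw d => est n fun j => drawRecord θ₀ (ω (ℓ + j)) :=
  (hest n).1.comp (measurable_pi_lambda _ fun _ =>
    (measurable_drawRecord θ₀).comp (measurable_pi_apply _))

lemma measurable_l2 {n : ℕ} : Measurable (l2 : (Fin n → ℝ) → ℝ) :=
  (Finset.measurable_sum _ fun i _ => (measurable_pi_apply i).mul (measurable_pi_apply i)).sqrt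

lemma l2_sub_sq_le_of_mem_paramSet {Wθ : ℝ} {θ θ₀ : Fin (d + 1) → ℝ} (h : θ ∈ paramSet d Wθ)
    (h₀ : θ₀ ∈ paramSet d Wθ) : l2 (θ - θ₀) ^ 2 ≤ 4 * Wθ ^ 2 := by
  have : l2 (θ - θ₀) ≤ 2 * Wθ := (l2_sub_le _ _).trans
    (by linarith [l2_le_of_mem_paramSet h, l2_le_of_mem_paramSet h₀])
  have := pow_le_pow_left₀ (l2_nonneg _) this 2
  linarith

lemma NoiseAssumption.exists_mle_rate (hν : NoiseAssumption ν) {B Wx Wθ lam : ℝ} (hB : 0 < B)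
    (hWx : 0 < Wx) (hWθ : 0 < Wθ) (hlam : 0 < lam) :
    ∃ C : ℝ, 0 < C ∧ ∀ (d : ℕ) (est : Estimator d), IsMLE ν Wθ est → ∀ θ₀ ∈ paramSet d Wθ,
      ∀ P ∈ featureLaws d Wx lam, ∀ ℓ n : ℕ, 0 < n →
      ∫ ω, l2 (est n (fun j => drawRecord θ₀ (ω (ℓ + j))) - θ₀) ^ 2 ∂(sampleLaw ν B P) ≤ C / n := by
  obtain ⟨c, hc0, hc⟩ := hν.exists_pdf_lower_bound (B + Wθ * Wx)
  obtain ⟨M, hM, hb⟩ := hν.exists_logLik_bounds (B + Wθ * Wx)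
  obtain ⟨C, hC, hdet⟩ := l2_mle_sub_sq_le hν hM hWx hWθ
    (by positivity : 0 < c ^ 2 * lam) hb
  set D := Wx ^ 2 / lam with hD
  have hDp : 0 < D := by positivity
  refine ⟨C * (D * (M * Wx) ^ 2 + D * (D * (M * Wx ^ 2) ^ 2)), by positivity, ?_⟩
  intro d est hest θ₀ hθ₀ P hP ℓ n hn
  have := hP.1
  have := isProbabilityMeasure_drawLaw hν hB P
  have hnR : (0 : ℝ) < n := by exact_mod_cast hn
  have hdim := dim_le_of_mem_featureLaws hlam hP
  have bS : ∀ i, ∀ᵐ w ∂(drawLaw ν B P), |drawScore ν θ₀ i w| ≤ M * Wx := fun i => by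
    filter_upwards [drawLaw_support hν hB hP] with w hw
    exact abs_drawScore_le (fun y u hu => (hb y u hu).1) hw.1 (abs_drawIndex_le hθ₀ hw.1 hw.2) i
  have bI : ∀ i k, ∀ᵐ w ∂(drawLaw ν B P), |drawInfo ν θ₀ i k w| ≤ M * Wx ^ 2 := fun i k => by
    filter_upwards [drawLaw_support hν hB hP] with w hw
    exact abs_drawInfo_le (fun y u hu => (hb y u hu).2.1) hw.1
      (abs_drawIndex_le hθ₀ hw.1 hw.2) i k
  have iS : ∀ i, Integrable (drawScore ν θ₀ i) (drawLaw ν B P) := fun i =>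
    Integrable.of_bound (measurable_drawScore hν θ₀ i).aestronglyMeasurable _ (bS i)
  have iI : ∀ i k, Integrable (drawInfo ν θ₀ i k) (drawLaw ν B P) := fun i k =>
    Integrable.of_bound (measurable_drawInfo hν θ₀ i k).aestronglyMeasurable _ (bI i k)
  have mS := fun i => integral_sampleMean_sub_sq_le (drawLaw ν B P)
    (measurable_drawScore hν θ₀ i) (bS i) ℓ hn
  simp only [fun i => integral_drawScore hν hB P θ₀ i (iS i), sub_zero] at mS
  have mI := fun i k => integral_sampleMean_sub_sq_le (drawLaw ν B P)
    (measurable_drawInfo hν θ₀ i k) (bI i k) ℓ hn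
  set H : Fin (d + 1) → Fin (d + 1) → ℝ :=
    fun i k => ∫ w, drawInfo ν θ₀ i k w ∂(drawLaw ν B P) with hH
  have hHl := fisher_lower_bound hν hB hc0 hP hθ₀ hc iI
  have hiS := integrable_finsetSum Finset.univ fun i _ => (mS i).1
  have hiI := integrable_finsetSum Finset.univ fun i _ =>
    integrable_finsetSum Finset.univ fun k _ => (mI i k).1
  have hpt : ∀ᵐ ω ∂(sampleLaw ν B P),
      l2 (est n (fun j => drawRecord θ₀ (ω (ℓ + j))) - θ₀) ^ 2 ≤
      C * (∑ i, (1 / (n : ℝ) * ∑ j : Fin n, drawScore ν θ₀ i (ω (ℓ + j))) ^ 2 +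
        ∑ i, ∑ k, (1 / (n : ℝ) * ∑ j : Fin n, drawInfo ν θ₀ i k (ω (ℓ + j)) - H i k) ^ 2) := by
    filter_upwards [sampleLaw_support hν hB hP] with ω hω
    obtain ⟨h1, h2⟩ := (hest n).2 fun j => drawRecord θ₀ (ω (ℓ + j))
    exact hdet d n hn θ₀ hθ₀ _ h1 (fun j => ω (ℓ + j)) (fun j => (hω _).1)
      (fun j => abs_drawIndex_le hθ₀ (hω _).1 (hω _).2) (h2 hθ₀) H hHl
  have hmeas : AEStronglyMeasurable (fun ω : ℕ → Draw d =>
      l2 (est n (fun j => drawRecord θ₀ (ω (ℓ + j))) - θ₀) ^ 2) (sampleLaw ν B P) :=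
    ((measurable_l2.comp ((measurable_est hest θ₀ ℓ n).sub_const θ₀)).pow_const
      2).aestronglyMeasurable
  have hprob : IsProbabilityMeasure (sampleLaw ν B P) := by unfold sampleLaw; infer_instance
  have hint : Integrable (fun ω : ℕ → Draw d =>
      l2 (est n (fun j => drawRecord θ₀ (ω (ℓ + j))) - θ₀) ^ 2) (sampleLaw ν B P) :=
    Integrable.of_bound hmeas (4 * Wθ ^ 2) (Filter.Eventually.of_forall fun ω => by
      rw [Real.norm_eq_abs, abs_of_nonneg (sq_nonneg _)]
      exact l2_sub_sq_le_of_mem_paramSet ((hest n).2 _).1 hθ₀)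
  refine (integral_mono_ae hint ((hiS.add hiI).const_mul C) hpt).trans ?_
  rw [integral_const_mul]
  simp only [Pi.add_apply, sampleLaw]
  rw [integral_add hiS hiI, integral_finsetSum _ fun i _ => (mS i).1,
    integral_finsetSum _ fun i _ => integrable_finsetSum _ fun k _ => (mI i k).1]
  simp_rw [fun i => integral_finsetSum Finset.univ fun k _ => (mI i k).1]
  have s1 := Finset.sum_le_sum fun i (_ : i ∈ Finset.univ) => (mS i).2
  have s2 := Finset.sum_le_sum fun i (_ : i ∈ Finset.univ) =>
    Finset.sum_le_sum fun k (_ : k ∈ Finset.univ) => (mI i k).2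
  simp only [Finset.sum_const, Finset.card_univ, Fintype.card_fin, nsmul_eq_mul, Nat.cast_add,
    Nat.cast_one] at s1 s2
  rw [mul_div_assoc]
  refine mul_le_mul_of_nonneg_left ?_ hC.le
  rw [add_div]
  refine add_le_add (s1.trans ?_) (s2.trans ?_)
  · rw [mul_div_assoc]; gcongr
  · rw [mul_div_assoc, mul_div_assoc]; gcongr

/-! ### Expected regret of one period -/

lemma revenue_nonneg {p : ℝ} (hp : 0 ≤ p) (v : ℝ) : 0 ≤ revenue p v := by
  unfold revenue; split_ifs <;> simp [hp]

lemma revenue_le {p : ℝ} (hp : 0 ≤ p) (v : ℝ) : revenue p v ≤ p := by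
  unfold revenue; split_ifs <;> simp [hp]

lemma measurable_revenue : Measurable fun q : ℝ × ℝ => revenue q.1 q.2 :=
  Measurable.ite (measurableSet_le measurable_fst measurable_snd) measurable_fst measurable_const

lemma NoiseAssumption.integrable_revenue (hν : NoiseAssumption ν) (p m : ℝ) :
    Integrable (fun z => revenue p (m + z)) ν := by
  have := hν.isProbabilityMeasure
  refine Integrable.of_bound (C := |p|) ?_ (Filter.Eventually.of_forall fun z => ?_)
  · exact (measurable_revenue.comp
      (measurable_const.prodMk (measurable_id.const_add m))).aestronglyMeasurable
  · unfold revenue; split_ifs <;> simp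

lemma NoiseAssumption.integral_revenue (hν : NoiseAssumption ν) (p m : ℝ) :
    ∫ z, revenue p (m + z) ∂ν = p * (1 - noiseCDF ν (p - m)) := by
  have h := hν.integral_threshold (p - m) p 0
  simp only [sub_le_iff_le_add'] at h
  simp only [revenue]
  rw [h]; ring

/-- Loss of revenue in one period when the estimate is `θ` and features are reported by `r`. -/
noncomputable def exploitLoss (ν : Measure ℝ) (A : Matrix (Fin d) (Fin d) ℝ)
    (r : (Fin d → ℝ) → Fin d → ℝ) (θ₀ θ : Fin (d + 1) → ℝ) (w : Draw d) : ℝ :=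
  revenue (pricing ν (θ₀ ⬝ᵥ augment w.feature)) (θ₀ ⬝ᵥ augment w.feature + w.noise) -
    revenue (exploitPrice ν A θ (r w.feature)) (θ₀ ⬝ᵥ augment w.feature + w.noise)

lemma continuous_augment : Continuous (augment : (Fin d → ℝ) → Fin (d + 1) → ℝ) := by
  refine continuous_pi fun i => ?_
  refine Fin.lastCases ?_ (fun j => ?_) i
  · simpa [augment] using continuous_const
  · simpa [augment] using continuous_apply j

lemma NoiseAssumption.measurable_exploitPrice (hν : NoiseAssumption ν)
    (A : Matrix (Fin d) (Fin d) ℝ) :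
    Measurable fun q : (Fin (d + 1) → ℝ) × (Fin d → ℝ) => exploitPrice ν A q.1 q.2 := by
  have h1 : Measurable fun q : (Fin (d + 1) → ℝ) × (Fin d → ℝ) => q.1 ⬝ᵥ augment q.2 :=
    (continuous_fst.dotProduct (continuous_augment.comp continuous_snd)).measurable
  have h2 : Continuous fun q : (Fin (d + 1) → ℝ) × (Fin d → ℝ) => slopePart q.1 :=
    continuous_pi fun i => (continuous_apply i.castSucc).comp continuous_fst
  have h3 : Measurable fun q : (Fin (d + 1) → ℝ) × (Fin d → ℝ) =>
      slopePart q.1 ⬝ᵥ A⁻¹ *ᵥ slopePart q.1 :=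
    (h2.dotProduct (continuous_const.matrix_mulVec h2)).measurable
  exact hν.continuous_pricing.measurable.comp (h1.add (h3.mul ((measurable_deriv _).comp h1)))

lemma NoiseAssumption.measurable_exploitLoss (hν : NoiseAssumption ν)
    (A : Matrix (Fin d) (Fin d) ℝ) {r : (Fin d → ℝ) → Fin d → ℝ} (hr : Measurable r)
    (θ₀ : Fin (d + 1) → ℝ) :
    Measurable fun q : (Fin (d + 1) → ℝ) × Draw d => exploitLoss ν A r θ₀ q.1 q.2 := by
  have hf : Measurable fun q : (Fin (d + 1) → ℝ) × Draw d => q.2.feature :=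
    measurable_feature.comp measurable_snd
  have hm : Measurable fun q : (Fin (d + 1) → ℝ) × Draw d => θ₀ ⬝ᵥ augment q.2.feature :=
    (measurable_dotProduct_const θ₀).comp (measurable_augment.comp hf)
  have hv := hm.add (measurable_noise.comp measurable_snd)
  exact (measurable_revenue.comp ((hν.continuous_pricing.measurable.comp hm).prodMk hv)).sub
    (measurable_revenue.comp
      (((hν.measurable_exploitPrice A).comp (measurable_fst.prodMk (hr.comp hf))).prodMk hv))

/-- Expectation over one draw of the loss caused by a fixed estimate. -/
lemma NoiseAssumption.integral_exploitLoss_le (hν : NoiseAssumption ν) {B Wx Wθ lam K ε : ℝ}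
    (hB : 0 < B) (hWθ : 0 < Wθ) (hK : 0 ≤ K)
    (hquad : ∀ m p, |m| ≤ Wθ * Wx → 0 ≤ p →
      pricing ν m * (1 - noiseCDF ν (pricing ν m - m)) - p * (1 - noiseCDF ν (p - m))
        ≤ K * (p - pricing ν m) ^ 2)
    {A : Matrix (Fin d) (Fin d) ℝ} {r : (Fin d → ℝ) → Fin d → ℝ}
    {θ₀ θ : Fin (d + 1) → ℝ} (hθ₀ : θ₀ ∈ paramSet d Wθ) {P : Measure (Fin d → ℝ)}
    (hP : P ∈ featureLaws d Wx lam)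
    (hprice : ∀ x, l2 (augment x) ≤ Wx →
      |exploitPrice ν A θ (r x) - pricing ν (θ₀ ⬝ᵥ augment x)| ≤ ε)
    (hint : Integrable (exploitLoss ν A r θ₀ θ) (drawLaw ν B P)) :
    ∫ w, exploitLoss ν A r θ₀ θ w ∂(drawLaw ν B P) ≤ K * ε ^ 2 := by
  have := hP.1
  have := hν.isProbabilityMeasure
  have := isProbabilityMeasure_uniform hB
  unfold drawLaw at hint ⊢
  rw [integral_prod _ hint]
  have h1 : ∀ᵐ x ∂P, ∫ y, exploitLoss ν A r θ₀ θ (x, y) ∂(ν.prod (volume[|Ioo 0 B])) ≤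
      K * ε ^ 2 := by
    filter_upwards [l2_augment_le_ae hP] with x hx
    have hm : |θ₀ ⬝ᵥ augment x| ≤ Wθ * Wx := (abs_dotProduct_le _ _).trans
      (mul_le_mul (l2_le_of_mem_paramSet hθ₀) hx (l2_nonneg _) hWθ.le)
    set m := θ₀ ⬝ᵥ augment x with hmdef
    set p := exploitPrice ν A θ (r x) with hpdef
    have e := integral_fun_fst (μ := ν) (ν := (volume : Measure ℝ)[|Ioo 0 B])
      (fun z => revenue (pricing ν m) (m + z) - revenue p (m + z))
    rw [probReal_univ, one_smul, integral_sub (hν.integrable_revenue _ _)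
      (hν.integrable_revenue _ _), hν.integral_revenue, hν.integral_revenue] at e
    refine (le_of_eq e).trans ((hquad m p hm (hν.pricing_pos _).le).trans ?_)
    rw [← sq_abs]
    gcongr
    exact hprice x hx
  have h2 : ∫ x, ∫ y, exploitLoss ν A r θ₀ θ (x, y) ∂(ν.prod (volume[|Ioo 0 B])) ∂P ≤
      ∫ _, K * ε ^ 2 ∂P := integral_mono_ae hint.integral_prod_left (integrable_const _) h1
  simpa using h2

/-- The draws of a block of periods are independent of the draw of a period outside the block. -/
lemma indepFun_block {X : Type*} [MeasurableSpace X] (μ : Measure X) [IsProbabilityMeasure μ]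
    {ℓ n t : ℕ} (ht : ℓ + n ≤ t) :
    (fun ω : ℕ → X => fun j : Fin n => ω (ℓ + j)) ⟂ᵢ[Measure.infinitePi fun _ => μ]
      (fun ω => ω t) := by
  have h := iIndepFun_infinitePi (P := fun _ : ℕ => μ) (X := fun _ => (id : X → X))
    fun _ => measurable_id
  have hdisj : Disjoint (Finset.Ico ℓ (ℓ + n)) {t} := by
    simp; omega
  have h2 := h.indepFun_finset _ _ hdisj fun i => measurable_pi_apply i
  exact h2.comp
    (φ := fun (a : (Finset.Ico ℓ (ℓ + n)) → X) (j : Fin n) => a ⟨ℓ + j, by simp⟩)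
    (ψ := fun a : ({t} : Finset ℕ) → X => a ⟨t, by simp⟩)
    (measurable_pi_lambda _ fun _ => measurable_pi_apply _) (measurable_pi_apply _)

/-- Fubini for an estimate and an independent draw. -/
lemma integral_estimate_draw {X Y Z : Type*} [MeasurableSpace X] [MeasurableSpace Y]
    [MeasurableSpace Z] (π : Measure Z) [IsProbabilityMeasure π] {f : Z → X} {g : Z → Y}
    (hf : Measurable f) (hg : Measurable g) (hind : f ⟂ᵢ[π] g) {Φ : X × Y → ℝ}
    (hΦ : Measurable Φ) (hint : Integrable (fun ω => Φ (f ω, g ω)) π) :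
    Integrable (fun ω => ∫ y, Φ (f ω, y) ∂(π.map g)) π ∧
      ∫ ω, Φ (f ω, g ω) ∂π = ∫ ω, ∫ y, Φ (f ω, y) ∂(π.map g) ∂π := by
  have := Measure.isProbabilityMeasure_map hf.aemeasurable (μ := π)
  have := Measure.isProbabilityMeasure_map hg.aemeasurable (μ := π)
  have hmap := (indepFun_iff_map_prod_eq_prod_map_map hf.aemeasurable hg.aemeasurable).mp hind
  have hfg : Measurable fun ω => (f ω, g ω) := hf.prodMk hg
  have hint2 : Integrable Φ ((π.map f).prod (π.map g)) := by
    rw [← hmap, integrable_map_measure hΦ.aestronglyMeasurable hfg.aemeasurable]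
    exact hint
  constructor
  · exact hint2.integral_prod_left.comp_measurable hf
  · rw [← integral_map hfg.aemeasurable (f := Φ) hΦ.aestronglyMeasurable, hmap,
      integral_prod _ hint2, integral_map hf.aemeasurable]
    exact hint2.integral_prod_left.aestronglyMeasurable

/-- Mean squared error of the estimate in terms of the unrounded exploration length. -/
lemma NoiseAssumption.exists_mle_rate_floor (hν : NoiseAssumption ν) {B Wx Wθ lam : ℝ}
    (hB : 0 < B) (hWx : 0 < Wx) (hWθ : 0 < Wθ) (hlam : 0 < lam) :
    ∃ C : ℝ, 0 < C ∧ ∀ (d : ℕ) (est : Estimator d), IsMLE ν Wθ est → ∀ θ₀ ∈ paramSet d Wθ,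
      ∀ P ∈ featureLaws d Wx lam, ∀ (ℓ : ℕ) (a : ℝ), 0 < a →
      ∫ ω, l2 (est ⌊a⌋₊ (fun j => drawRecord θ₀ (ω (ℓ + j))) - θ₀) ^ 2 ∂(sampleLaw ν B P)
        ≤ C / a := by
  obtain ⟨C, hC, h⟩ := hν.exists_mle_rate hB hWx hWθ hlam
  refine ⟨2 * C + 4 * Wθ ^ 2, by positivity, fun d est hest θ₀ hθ₀ P hP ℓ a ha => ?_⟩
  have := hP.1
  have := isProbabilityMeasure_drawLaw hν hB P
  rcases Nat.eq_zero_or_pos ⌊a⌋₊ with h0 | h0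
  · have ha1 : a < 1 := Nat.floor_eq_zero.mp h0
    have hprob : IsProbabilityMeasure (sampleLaw ν B P) := by unfold sampleLaw; infer_instance
    have h1 : ∫ ω, l2 (est ⌊a⌋₊ (fun j => drawRecord θ₀ (ω (ℓ + j))) - θ₀) ^ 2
        ∂(sampleLaw ν B P) ≤ ∫ _, 4 * Wθ ^ 2 ∂(sampleLaw ν B P) :=
      integral_mono_of_nonneg (Filter.Eventually.of_forall fun ω => sq_nonneg _)
        (integrable_const _) (Filter.Eventually.of_forall fun ω =>
          l2_sub_sq_le_of_mem_paramSet ((hest _).2 _).1 hθ₀)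
    refine h1.trans ?_
    rw [integral_const, probReal_univ, one_smul, le_div_iff₀ ha]
    nlinarith [sq_nonneg Wθ]
  · refine (h d est hest θ₀ hθ₀ P hP ℓ _ h0).trans ?_
    have h1 : (1 : ℝ) ≤ ⌊a⌋₊ := by exact_mod_cast h0
    have h2 := Nat.lt_floor_add_one a
    rw [div_le_div_iff₀ (by linarith) ha]
    nlinarith [sq_nonneg Wθ]

/-- Expected regret of one period. -/
lemma NoiseAssumption.exists_period_regret (hν : NoiseAssumption ν) {B Wx Wθ lam : ℝ}
    (hB : 0 < B) (hWx : 0 < Wx) (hWθ : 0 < Wθ) (hlam : 0 < lam) :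
    ∃ G C : ℝ, 0 < G ∧ 0 < C ∧ ∀ lamA₀ : ℝ, 0 < lamA₀ → ∃ Q : ℝ, 0 < Q ∧
      ∀ (d : ℕ) (A : Matrix (Fin d) (Fin d) ℝ), A.PosDef → lamA₀ ≤ minEigenvalue A →
      ∀ (Ca : ℝ), 0 < Ca → ∀ ℓ₀ : ℕ, 1 ≤ ℓ₀ → ∀ est : Estimator d, IsMLE ν Wθ est →
      ∀ resp : Response d, IsManipulation ν A resp →
      ∀ θ₀ ∈ paramSet d Wθ, ∀ P ∈ featureLaws d Wx lam, ∀ t : ℕ,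
      Integrable (fun ω => revenue (oraclePrice ν θ₀ ω t) (valuation θ₀ ω t) -
        revenue (postedPrice ν A Ca ℓ₀ est resp θ₀ ω t) (valuation θ₀ ω t)) (sampleLaw ν B P) ∧
      ∫ ω, (revenue (oraclePrice ν θ₀ ω t) (valuation θ₀ ω t) -
        revenue (postedPrice ν A Ca ℓ₀ est resp θ₀ ω t) (valuation θ₀ ω t)) ∂(sampleLaw ν B P) ≤
        if t < episodeLength ℓ₀ (episodeOf ℓ₀ t) + exploreLength Ca ℓ₀ (episodeOf ℓ₀ t) then G
        else C * (Wx + Q / minEigenvalue A) ^ 2 /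
          Real.sqrt (Ca * episodeLength ℓ₀ (episodeOf ℓ₀ t)) := by
  obtain ⟨K, hK, hquad⟩ := hν.exists_revenue_quadratic (Wθ * Wx)
  obtain ⟨C, hC, hrate⟩ := hν.exists_mle_rate_floor hB hWx hWθ hlam
  set G := pricing ν 0 + Wθ * Wx with hG
  have hGp : 0 < G := by have := hν.pricing_pos 0; positivity
  refine ⟨G, K * C, hGp, by positivity, fun lamA₀ hlamA₀ => ?_⟩
  obtain ⟨Q, hQ, hprice⟩ := hν.exists_exploitPrice_lipschitz hWx hWθ hlamA₀
  refine ⟨Q, hQ, fun d A hA hlamA Ca hCa ℓ₀ hℓ₀ est hest resp hresp θ₀ hθ₀ P hP t => ?_⟩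
  have := hP.1
  have := isProbabilityMeasure_drawLaw hν hB P
  have hprob : IsProbabilityMeasure (sampleLaw ν B P) := by unfold sampleLaw; infer_instance
  have hm : ∀ x : Fin d → ℝ, l2 (augment x) ≤ Wx → |θ₀ ⬝ᵥ augment x| ≤ Wθ * Wx := fun x hx =>
    (abs_dotProduct_le _ _).trans
      (mul_le_mul (l2_le_of_mem_paramSet hθ₀) hx (l2_nonneg _) hWθ.le)
  have horacle : ∀ x : Fin d → ℝ, l2 (augment x) ≤ Wx → pricing ν (θ₀ ⬝ᵥ augment x) ≤ G :=
    fun x hx => (hν.pricing_le _).trans (by rw [hG]; linarith [hm x hx])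
  have hft : Measurable fun ω : ℕ → Draw d => (ω t).feature :=
    measurable_feature.comp (measurable_pi_apply t)
  have hmt : Measurable fun ω : ℕ → Draw d => θ₀ ⬝ᵥ augment (ω t).feature :=
    (measurable_dotProduct_const θ₀).comp (measurable_augment.comp hft)
  have hvt : Measurable fun ω : ℕ → Draw d => valuation θ₀ ω t :=
    hmt.add (measurable_noise.comp (measurable_pi_apply t))
  set k := episodeOf ℓ₀ t with hk
  by_cases hexp : t < episodeLength ℓ₀ k + exploreLength Ca ℓ₀ k
  · have hpost : ∀ ω, postedPrice ν A Ca ℓ₀ est resp θ₀ ω t = (ω t).uniformPrice := fun ω => by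
      simp only [postedPrice, ← hk, if_pos hexp]
    simp only [hpost, if_pos hexp]
    have hut : Measurable fun ω : ℕ → Draw d => (ω t).uniformPrice :=
      measurable_uniformPrice.comp (measurable_pi_apply t)
    have hmeas : Measurable fun ω : ℕ → Draw d =>
        revenue (oraclePrice ν θ₀ ω t) (valuation θ₀ ω t) -
          revenue (ω t).uniformPrice (valuation θ₀ ω t) :=
      (measurable_revenue.comp ((hν.continuous_pricing.measurable.comp hmt).prodMk hvt)).sub
        (measurable_revenue.comp (hut.prodMk hvt))
    have hbound : ∀ᵐ ω ∂(sampleLaw ν B P),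
        -B ≤ revenue (oraclePrice ν θ₀ ω t) (valuation θ₀ ω t) -
          revenue (ω t).uniformPrice (valuation θ₀ ω t) ∧
        revenue (oraclePrice ν θ₀ ω t) (valuation θ₀ ω t) -
          revenue (ω t).uniformPrice (valuation θ₀ ω t) ≤ G := by
      filter_upwards [sampleLaw_support hν hB hP] with ω hω
      obtain ⟨hx, hp⟩ := hω t
      have h0 : 0 ≤ oraclePrice ν θ₀ ω t := (hν.pricing_pos _).le
      have h1 := revenue_le h0 (valuation θ₀ ω t)
      have h2 := revenue_nonneg h0 (valuation θ₀ ω t)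
      have h3 := revenue_le hp.1.le (valuation θ₀ ω t)
      have h4 := revenue_nonneg hp.1.le (valuation θ₀ ω t)
      have h5 : oraclePrice ν θ₀ ω t ≤ G := horacle _ hx
      have h6 := hp.2
      constructor <;> linarith
    have hint := Integrable.of_bound hmeas.aestronglyMeasurable (μ := sampleLaw ν B P) (G + B) (by
      filter_upwards [hbound] with ω hω
      rw [Real.norm_eq_abs, abs_le]
      constructor <;> linarith [hω.1, hω.2])
    refine ⟨hint, ?_⟩
    have := integral_mono_ae hint (integrable_const G) (hbound.mono fun ω hω => hω.2)
    simpa using this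
  · set ℓ := episodeLength ℓ₀ k with hℓ
    set n := exploreLength Ca ℓ₀ k with hn
    set θh : (ℕ → Draw d) → Fin (d + 1) → ℝ :=
      fun ω => est n fun j => drawRecord θ₀ (ω (ℓ + j)) with hθh
    have hθm : Measurable θh := measurable_est hest θ₀ ℓ n
    have hθmem : ∀ ω, θh ω ∈ paramSet d Wθ := fun ω => ((hest n).2 _).1
    have hloss : ∀ ω, revenue (oraclePrice ν θ₀ ω t) (valuation θ₀ ω t) -
        revenue (postedPrice ν A Ca ℓ₀ est resp θ₀ ω t) (valuation θ₀ ω t) =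
        exploitLoss ν A (resp θ₀ t) θ₀ (θh ω) (ω t) := fun ω => by
      simp only [postedPrice, ← hk, ← hℓ, ← hn, if_neg hexp]
      rfl
    simp only [hloss, if_neg hexp]
    set lamA := minEigenvalue A with hlamAdef
    have hl : 0 < lamA := hlamA₀.trans_le hlamA
    have hp : ∀ θ ∈ paramSet d Wθ, ∀ x, l2 (augment x) ≤ Wx →
        |exploitPrice ν A θ (resp θ₀ t x) - pricing ν (θ₀ ⬝ᵥ augment x)|
          ≤ l2 (θ - θ₀) * (Wx + Q / lamA) := fun θ hθ x hx =>
      hprice d A hA hlamA θ₀ hθ₀ θ hθ x _ hx ((hresp θ₀ t).2 x)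
    have hΦ := hν.measurable_exploitLoss A (hresp θ₀ t).1 θ₀
    have hlossb : ∀ θ ∈ paramSet d Wθ, ∀ w : Draw d, l2 (augment w.feature) ≤ Wx →
        |exploitLoss ν A (resp θ₀ t) θ₀ θ w| ≤ 2 * G + 2 * Wθ * (Wx + Q / lamA) := by
      intro θ hθ w hx
      have h0 : 0 ≤ pricing ν (θ₀ ⬝ᵥ augment w.feature) := (hν.pricing_pos _).le
      have h0' : 0 ≤ exploitPrice ν A θ (resp θ₀ t w.feature) := (hν.pricing_pos _).le
      have h1 := revenue_le h0 (θ₀ ⬝ᵥ augment w.feature + w.noise)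
      have h2 := revenue_nonneg h0 (θ₀ ⬝ᵥ augment w.feature + w.noise)
      have h3 := revenue_le h0' (θ₀ ⬝ᵥ augment w.feature + w.noise)
      have h4 := revenue_nonneg h0' (θ₀ ⬝ᵥ augment w.feature + w.noise)
      have h5 := horacle _ hx
      have h6 := (abs_le.mp (hp θ hθ _ hx)).2
      have h7 : l2 (θ - θ₀) ≤ 2 * Wθ := (l2_sub_le _ _).trans
        (by linarith [l2_le_of_mem_paramSet hθ, l2_le_of_mem_paramSet hθ₀])
      have h8 : l2 (θ - θ₀) * (Wx + Q / lamA) ≤ 2 * Wθ * (Wx + Q / lamA) := by gcongr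
      have h9 : 0 ≤ 2 * Wθ * (Wx + Q / lamA) := by positivity
      rw [exploitLoss, abs_le]
      constructor <;> linarith
    have hint : Integrable (fun ω => exploitLoss ν A (resp θ₀ t) θ₀ (θh ω) (ω t))
        (sampleLaw ν B P) := by
      refine Integrable.of_bound (C := 2 * G + 2 * Wθ * (Wx + Q / lamA)) ?_ ?_
      · exact (hΦ.comp (hθm.prodMk (measurable_pi_apply t))).aestronglyMeasurable
      · filter_upwards [sampleLaw_support hν hB hP] with ω hω
        exact hlossb _ (hθmem ω) _ (hω t).1
    refine ⟨hint, ?_⟩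
    have hind : θh ⟂ᵢ[sampleLaw ν B P] fun ω => ω t := by
      have h := indepFun_block (drawLaw ν B P) (ℓ := ℓ) (n := n) (t := t) (not_lt.mp hexp)
      exact h.comp (φ := fun D => est n fun j => drawRecord θ₀ (D j)) (ψ := id)
        ((hest n).1.comp (measurable_pi_lambda _ fun j =>
          (measurable_drawRecord θ₀).comp (measurable_pi_apply j))) measurable_id
    have hmapt : (sampleLaw ν B P).map (fun ω => ω t) = drawLaw ν B P :=
      Measure.infinitePi_map_eval (fun _ => drawLaw ν B P) t
    obtain ⟨hi2, hfub⟩ := integral_estimate_draw (sampleLaw ν B P) hθm (measurable_pi_apply t)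
      hind hΦ hint
    rw [hmapt] at hi2 hfub
    rw [hfub]
    have hinner : ∀ ω, ∫ y, exploitLoss ν A (resp θ₀ t) θ₀ (θh ω) y ∂(drawLaw ν B P) ≤
        K * (Wx + Q / lamA) ^ 2 * l2 (θh ω - θ₀) ^ 2 := by
      intro ω
      have hi : Integrable (exploitLoss ν A (resp θ₀ t) θ₀ (θh ω)) (drawLaw ν B P) := by
        refine Integrable.of_bound (C := 2 * G + 2 * Wθ * (Wx + Q / lamA))
          (hΦ.comp measurable_prodMk_left).aestronglyMeasurable ?_
        filter_upwards [drawLaw_support hν hB hP] with w hw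
        exact hlossb _ (hθmem ω) _ hw.1
      refine (hν.integral_exploitLoss_le hB hWθ hK.le hquad hθ₀ hP (hp _ (hθmem ω))
        hi).trans (le_of_eq ?_)
      ring
    have hsqint : Integrable (fun ω => l2 (θh ω - θ₀) ^ 2) (sampleLaw ν B P) :=
      Integrable.of_bound ((measurable_l2.comp (hθm.sub_const θ₀)).pow_const
        2).aestronglyMeasurable (4 * Wθ ^ 2) (Filter.Eventually.of_forall fun ω => by
          rw [Real.norm_eq_abs, abs_of_nonneg (sq_nonneg _)]
          exact l2_sub_sq_le_of_mem_paramSet (hθmem ω) hθ₀)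
    refine (integral_mono hi2 (hsqint.const_mul _) hinner).trans ?_
    rw [integral_const_mul]
    have hℓpos : 0 < ℓ := Nat.mul_pos (by positivity) hℓ₀
    have hsq : 0 < Real.sqrt (Ca * ℓ) := Real.sqrt_pos.mpr (by positivity)
    have := hrate d est hest θ₀ hθ₀ P hP ℓ _ hsq
    calc _ ≤ K * (Wx + Q / lamA) ^ 2 * (C / Real.sqrt (Ca * ℓ)) :=
          mul_le_mul_of_nonneg_left this (by positivity)
      _ = _ := by ring

/-! ### Summation over the periods -/

lemma episodeLength_episodeOf_le {ℓ₀ t : ℕ} (hℓ₀ : 1 ≤ ℓ₀) (ht : ℓ₀ ≤ t) :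
    episodeLength ℓ₀ (episodeOf ℓ₀ t) ≤ t := by
  have h1 : t / ℓ₀ ≠ 0 := (Nat.div_pos ht hℓ₀).ne'
  rw [episodeLength, episodeOf, Nat.add_sub_cancel]
  exact (Nat.mul_le_mul_right _ (Nat.pow_log_le_self 2 h1)).trans (Nat.div_mul_le_self t ℓ₀)

lemma lt_two_mul_episodeLength_episodeOf {ℓ₀ t : ℕ} (hℓ₀ : 1 ≤ ℓ₀) :
    t < 2 * episodeLength ℓ₀ (episodeOf ℓ₀ t) := by
  rw [episodeLength, episodeOf, Nat.add_sub_cancel, ← mul_assoc, ← pow_succ']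
  exact (Nat.div_lt_iff_lt_mul hℓ₀).mp (Nat.lt_pow_succ_log_self one_lt_two _)

lemma sum_sqrt_two_pow_le (m : ℕ) :
    ∑ i ∈ Finset.range (m + 1), Real.sqrt (2 ^ i) ≤ 4 * Real.sqrt (2 ^ m) := by
  induction m with
  | zero => simp
  | succ m ih =>
    rw [Finset.sum_range_succ]
    have e : Real.sqrt (2 ^ (m + 1)) = Real.sqrt 2 * Real.sqrt (2 ^ m) := by
      rw [pow_succ', Real.sqrt_mul (by norm_num)]
    have h2 : 4 / 3 ≤ Real.sqrt 2 := Real.le_sqrt_of_sq_le (by norm_num)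
    rw [e] at *
    nlinarith [Real.sqrt_nonneg (2 ^ m : ℝ)]

lemma sum_inv_sqrt_le (T : ℕ) :
    ∑ t ∈ Finset.Icc 1 T, 1 / Real.sqrt t ≤ 2 * Real.sqrt T := by
  induction T with
  | zero => simp
  | succ T ih =>
    rw [Finset.sum_Icc_succ_top (by omega)]
    have hs : 0 < Real.sqrt ((T + 1 : ℕ) : ℝ) := Real.sqrt_pos.mpr (by positivity)
    have h1 := Real.sq_sqrt (Nat.cast_nonneg (α := ℝ) T)
    have h2 := Real.sq_sqrt (Nat.cast_nonneg (α := ℝ) (T + 1))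
    have h3 := Real.sqrt_nonneg (T : ℝ)
    have h4 : 1 / Real.sqrt ((T + 1 : ℕ) : ℝ) ≤
        2 * Real.sqrt ((T + 1 : ℕ) : ℝ) - 2 * Real.sqrt T := by
      rw [div_le_iff₀ hs]
      have h5 : Real.sqrt ((T + 1 : ℕ) : ℝ) ^ 2 = Real.sqrt T ^ 2 + 1 := by
        rw [h1, h2]; push_cast; ring
      nlinarith [sq_nonneg (Real.sqrt ((T + 1 : ℕ) : ℝ) - Real.sqrt T)]
    linarith

/-- Number of exploration periods up to period `T`. -/
lemma card_explore_le {Ca : ℝ} (hCa : 0 < Ca) {ℓ₀ : ℕ} (hℓ₀ : 1 ≤ ℓ₀) (T : ℕ) :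
    (((Finset.Icc ℓ₀ T).filter fun t => t < episodeLength ℓ₀ (episodeOf ℓ₀ t) +
      exploreLength Ca ℓ₀ (episodeOf ℓ₀ t)).card : ℝ) ≤ 4 * Real.sqrt (Ca * T) := by
  rcases lt_or_ge T ℓ₀ with hT | hT
  · rw [Finset.Icc_eq_empty_of_lt hT, Finset.filter_empty, Finset.card_empty, Nat.cast_zero]
    positivity
  set m := Nat.log 2 (T / ℓ₀) with hm
  have hsub : ((Finset.Icc ℓ₀ T).filter fun t => t < episodeLength ℓ₀ (episodeOf ℓ₀ t) +
      exploreLength Ca ℓ₀ (episodeOf ℓ₀ t)) ⊆ (Finset.range (m + 1)).biUnion fun i =>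
      Finset.Ico (episodeLength ℓ₀ (i + 1)) (episodeLength ℓ₀ (i + 1) +
        exploreLength Ca ℓ₀ (i + 1)) := by
    intro t ht
    rw [Finset.mem_filter, Finset.mem_Icc] at ht
    rw [Finset.mem_biUnion]
    refine ⟨Nat.log 2 (t / ℓ₀), ?_, ?_⟩
    · rw [Finset.mem_range, Nat.lt_succ_iff]
      exact Nat.log_mono_right (Nat.div_le_div_right ht.1.2)
    · rw [Finset.mem_Ico]
      exact ⟨episodeLength_episodeOf_le hℓ₀ ht.1.1, ht.2⟩
  have h1 := (Finset.card_le_card hsub).trans Finset.card_biUnion_le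
  simp only [Nat.card_Ico, Nat.add_sub_cancel_left] at h1
  have h2 : ∀ i ∈ Finset.range (m + 1), (exploreLength Ca ℓ₀ (i + 1) : ℝ) ≤
      Real.sqrt (Ca * ℓ₀) * Real.sqrt (2 ^ i) := fun i _ => by
    rw [exploreLength]
    refine (Nat.floor_le (Real.sqrt_nonneg _)).trans (le_of_eq ?_)
    rw [← Real.sqrt_mul (by positivity), episodeLength, Nat.add_sub_cancel]
    push_cast
    ring_nf
  have hT2 : ((2 ^ m * ℓ₀ : ℕ) : ℝ) ≤ T := by
    have := episodeLength_episodeOf_le hℓ₀ hT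
    rw [episodeLength, episodeOf, Nat.add_sub_cancel] at this
    exact_mod_cast this
  calc _ ≤ ((∑ i ∈ Finset.range (m + 1), exploreLength Ca ℓ₀ (i + 1) : ℕ) : ℝ) := by
        exact_mod_cast h1
    _ ≤ ∑ i ∈ Finset.range (m + 1), Real.sqrt (Ca * ℓ₀) * Real.sqrt (2 ^ i) := by
        push_cast; exact Finset.sum_le_sum h2
    _ ≤ Real.sqrt (Ca * ℓ₀) * (4 * Real.sqrt (2 ^ m)) := by
        rw [← Finset.mul_sum]
        exact mul_le_mul_of_nonneg_left (sum_sqrt_two_pow_le m) (Real.sqrt_nonneg _)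
    _ = 4 * Real.sqrt (Ca * (2 ^ m * ℓ₀ : ℕ)) := by
        rw [mul_left_comm, ← Real.sqrt_mul (by positivity)]
        push_cast
        ring_nf
    _ ≤ 4 * Real.sqrt (Ca * T) := by gcongr

/-- Sum of the period bounds: a constant in exploration, and a multiple of `1 / √(C_a ℓ_k)` in
exploitation. -/
lemma sum_period_bound_le {Ca G D : ℝ} (hCa : 0 < Ca) (hG : 0 ≤ G) (hD : 0 ≤ D) {ℓ₀ : ℕ}
    (hℓ₀ : 1 ≤ ℓ₀) (T : ℕ) :
    ∑ t ∈ Finset.Icc ℓ₀ T, (if t < episodeLength ℓ₀ (episodeOf ℓ₀ t) +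
      exploreLength Ca ℓ₀ (episodeOf ℓ₀ t) then G
      else D / Real.sqrt (Ca * episodeLength ℓ₀ (episodeOf ℓ₀ t))) ≤
    4 * G * Real.sqrt (Ca * T) + 3 * D * Real.sqrt (T / Ca) := by
  have hterm : ∀ t ∈ Finset.Icc ℓ₀ T, (if t < episodeLength ℓ₀ (episodeOf ℓ₀ t) +
      exploreLength Ca ℓ₀ (episodeOf ℓ₀ t) then G
      else D / Real.sqrt (Ca * episodeLength ℓ₀ (episodeOf ℓ₀ t))) ≤
      (if t < episodeLength ℓ₀ (episodeOf ℓ₀ t) + exploreLength Ca ℓ₀ (episodeOf ℓ₀ t)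
        then G else 0) + D * Real.sqrt (2 / Ca) * (1 / Real.sqrt t) := by
    intro t ht
    rw [Finset.mem_Icc] at ht
    have htp : (0 : ℝ) < t := by exact_mod_cast lt_of_lt_of_le hℓ₀ ht.1
    split_ifs
    · have : 0 ≤ D * Real.sqrt (2 / Ca) * (1 / Real.sqrt t) := by positivity
      linarith
    · rw [zero_add, mul_assoc, mul_one_div, ← Real.sqrt_div (by positivity), div_eq_mul_inv,
        ← Real.sqrt_inv]
      refine mul_le_mul_of_nonneg_left (Real.sqrt_le_sqrt ?_) hD
      have h2 : (t : ℝ) ≤ 2 * episodeLength ℓ₀ (episodeOf ℓ₀ t) := by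
        exact_mod_cast (lt_two_mul_episodeLength_episodeOf hℓ₀).le
      rw [div_div, inv_eq_one_div, div_le_div_iff₀ (by nlinarith) (by positivity)]
      nlinarith
  refine (Finset.sum_le_sum hterm).trans ?_
  rw [Finset.sum_add_distrib, ← Finset.mul_sum]
  refine add_le_add ?_ ?_
  · rw [← Finset.sum_filter, Finset.sum_const, nsmul_eq_mul]
    have := mul_le_mul_of_nonneg_right (card_explore_le hCa hℓ₀ T) hG
    linarith
  · have h1 : ∑ t ∈ Finset.Icc ℓ₀ T, 1 / Real.sqrt t ≤ 2 * Real.sqrt T :=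
      (Finset.sum_le_sum_of_subset_of_nonneg (Finset.Icc_subset_Icc_left hℓ₀)
        fun _ _ _ => by positivity).trans (sum_inv_sqrt_le T)
    have h2 := mul_le_mul_of_nonneg_left h1 (by positivity : 0 ≤ D * Real.sqrt (2 / Ca))
    refine h2.trans ?_
    have e : Real.sqrt (2 / Ca) * Real.sqrt T = Real.sqrt 2 * Real.sqrt (T / Ca) := by
      rw [← Real.sqrt_mul (by positivity), ← Real.sqrt_mul (by norm_num)]
      ring_nf
    have h3 : Real.sqrt 2 ≤ 3 / 2 := Real.sqrt_le_iff.mpr ⟨by norm_num, by norm_num⟩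
    have h4 : D * Real.sqrt (2 / Ca) * (2 * Real.sqrt T) =
        2 * D * (Real.sqrt 2 * Real.sqrt (T / Ca)) := by rw [← e]; ring
    rw [h4]
    have h5 := mul_le_mul_of_nonneg_right h3 (Real.sqrt_nonneg (T / Ca))
    have h6 := mul_le_mul_of_nonneg_left h5 (by positivity : 0 ≤ 2 * D)
    linarith

/-- The two contributions to the regret combine into the stated form. -/
lemma regret_constant_bound {G C Wx Q κ₁ κ₂ κ₃ lam lamA₀ Ca T D : ℝ} (hG : 0 < G) (hC : 0 < C)
    (hWx : 0 < Wx) (hQ : 0 < Q) (hκ₁ : 0 < κ₁) (hlamA₀ : 0 < lamA₀) (hlam : lamA₀ ≤ lam)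
    (hD : 1 ≤ D) (hT : 0 ≤ T) (h1 : κ₁ * D ≤ Ca) (h2 : Ca ≤ (κ₂ + κ₃ / lam ^ 2) * D) :
    4 * G * Real.sqrt (Ca * T) + 3 * (C * (Wx + Q / lam) ^ 2) * Real.sqrt (T / Ca) ≤
      Real.sqrt ((32 * G ^ 2 * |κ₂| + 144 * C ^ 2 / κ₁ * Wx ^ 4) +
        (32 * G ^ 2 * |κ₃| + 144 * C ^ 2 / κ₁ * (Q ^ 4 / lamA₀ ^ 2)) / lam ^ 2) *
        Real.sqrt (D * T) := by
  have hl : 0 < lam := hlamA₀.trans_le hlam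
  have hDp : 0 < D := by linarith
  have hCa : 0 < Ca := (by positivity : 0 < κ₁ * D).trans_le h1
  have hE : 0 < |κ₂| + |κ₃| / lam ^ 2 := by
    have h3 : 0 < (κ₂ + κ₃ / lam ^ 2) * D := hCa.trans_le h2
    have h4 : 0 < κ₂ + κ₃ / lam ^ 2 := pos_of_mul_pos_left h3 hDp.le
    have h5 : κ₃ / lam ^ 2 ≤ |κ₃| / lam ^ 2 := by gcongr; exact le_abs_self _
    linarith [le_abs_self κ₂]
  have hCaD : Ca ≤ (|κ₂| + |κ₃| / lam ^ 2) * D := by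
    refine h2.trans ?_
    gcongr
    · exact le_abs_self _
    · exact le_abs_self _
  have b1 : Real.sqrt (Ca * T) ≤ Real.sqrt (|κ₂| + |κ₃| / lam ^ 2) * Real.sqrt (D * T) := by
    rw [← Real.sqrt_mul hE.le, ← mul_assoc]
    gcongr
  have b2 : Real.sqrt (T / Ca) ≤ Real.sqrt (1 / κ₁) * Real.sqrt (D * T) := by
    rw [← Real.sqrt_mul (by positivity)]
    apply Real.sqrt_le_sqrt
    rw [div_le_iff₀ hCa]
    have h3 : κ₁ ≤ Ca := by nlinarith
    calc T = 1 / κ₁ * (1 * T) * κ₁ := by field_simp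
      _ ≤ 1 / κ₁ * (D * T) * Ca := by gcongr
  set X := 4 * G * Real.sqrt (|κ₂| + |κ₃| / lam ^ 2) with hX
  set Y := 3 * (C * (Wx + Q / lam) ^ 2) * Real.sqrt (1 / κ₁) with hY
  have hXsq : X ^ 2 = 16 * G ^ 2 * (|κ₂| + |κ₃| / lam ^ 2) := by
    rw [hX, mul_pow, Real.sq_sqrt hE.le]; ring
  have hYsq : Y ^ 2 = 9 * C ^ 2 / κ₁ * (Wx + Q / lam) ^ 4 := by
    rw [hY, mul_pow, Real.sq_sqrt (by positivity)]; ring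
  have hfour : (Wx + Q / lam) ^ 4 ≤ 8 * (Wx ^ 4 + Q ^ 4 / lamA₀ ^ 2 / lam ^ 2) := by
    have h3 : (Wx + Q / lam) ^ 4 ≤ 8 * (Wx ^ 4 + (Q / lam) ^ 4) := by
      have e1 := add_sq_le (a := Wx) (b := Q / lam)
      have e2 := pow_le_pow_left₀ (sq_nonneg (Wx + Q / lam)) e1 2
      have e3 := add_sq_le (a := Wx ^ 2) (b := (Q / lam) ^ 2)
      linarith
    have h4 : (Q / lam) ^ 4 ≤ Q ^ 4 / lamA₀ ^ 2 / lam ^ 2 := by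
      rw [div_pow, div_div]
      have : lamA₀ ^ 2 * lam ^ 2 ≤ lam ^ 4 := by
        rw [show lam ^ 4 = lam ^ 2 * lam ^ 2 by ring]
        gcongr
      gcongr
    linarith
  have hsum : X + Y ≤ Real.sqrt ((32 * G ^ 2 * |κ₂| + 144 * C ^ 2 / κ₁ * Wx ^ 4) +
        (32 * G ^ 2 * |κ₃| + 144 * C ^ 2 / κ₁ * (Q ^ 4 / lamA₀ ^ 2)) / lam ^ 2) := by
    apply Real.le_sqrt_of_sq_le
    have h5 : (X + Y) ^ 2 ≤ 2 * X ^ 2 + 2 * Y ^ 2 := by nlinarith [sq_nonneg (X - Y)]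
    have h6 : Y ^ 2 ≤ 9 * C ^ 2 / κ₁ * (8 * (Wx ^ 4 + Q ^ 4 / lamA₀ ^ 2 / lam ^ 2)) := by
      rw [hYsq]; gcongr
    refine h5.trans ?_
    rw [hXsq]
    refine (add_le_add_right (mul_le_mul_of_nonneg_left h6 zero_le_two) _).trans (le_of_eq ?_)
    ring
  calc _ ≤ 4 * G * (Real.sqrt (|κ₂| + |κ₃| / lam ^ 2) * Real.sqrt (D * T)) +
        3 * (C * (Wx + Q / lam) ^ 2) * (Real.sqrt (1 / κ₁) * Real.sqrt (D * T)) := by gcongr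
    _ = (X + Y) * Real.sqrt (D * T) := by rw [hX, hY]; ring
    _ ≤ _ := mul_le_mul_of_nonneg_right hsum (Real.sqrt_nonneg _)

end StrategicPricing

theorem theorem2
    (ν : MeasureTheory.Measure ℝ) (hν : StrategicPricing.NoiseAssumption ν)
    (B Wx Wθ lamX κ₁ κ₂ : ℝ) (hB : 0 < B) (hWx : 0 < Wx) (hWθ : 0 < Wθ) (hlamX : 0 < lamX)
    (hκ₁ : 0 < κ₁) :
    ∃ C₁ : ℝ, 0 < C₁ ∧ ∀ (lamA₀ κ₃ : ℝ), 0 < lamA₀ → ∃ C₂ : ℝ, 0 < C₂ ∧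
      ∀ (d : ℕ), 1 ≤ d →
      ∀ (A : Matrix (Fin d) (Fin d) ℝ), A.PosDef → lamA₀ ≤ StrategicPricing.minEigenvalue A →
      ∀ (Ca : ℝ), κ₁ * (d + 1) ≤ Ca →
        Ca ≤ (κ₂ + κ₃ / StrategicPricing.minEigenvalue A ^ 2) * (d + 1) →
      ∀ (ℓ₀ : ℕ), 1 ≤ ℓ₀ →
      ∀ (est : StrategicPricing.Estimator d), StrategicPricing.IsMLE ν Wθ est →
      ∀ (resp : StrategicPricing.Response d), StrategicPricing.IsManipulation ν A resp →
      ∀ (T : ℕ),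
        (∀ θ₀ ∈ StrategicPricing.paramSet d Wθ, ∀ P ∈ StrategicPricing.featureLaws d Wx lamX,
          MeasureTheory.Integrable
            (StrategicPricing.realizedRegret ν A Ca ℓ₀ est resp θ₀ T)
            (StrategicPricing.sampleLaw ν B P)) ∧
        StrategicPricing.worstCaseRegret ν B Wx Wθ lamX A Ca ℓ₀ est resp T ≤
          ((Real.sqrt (C₁ + C₂ / StrategicPricing.minEigenvalue A ^ 2) *
            Real.sqrt ((d + 1) * T) : ℝ) : EReal) := by
  obtain ⟨G, C, hG, hC, hperiod⟩ := hν.exists_period_regret hB hWx hWθ hlamX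
  refine ⟨32 * G ^ 2 * |κ₂| + 144 * C ^ 2 / κ₁ * Wx ^ 4, by positivity, fun lamA₀ κ₃ hlamA₀ => ?_⟩
  obtain ⟨Q, hQ, hper⟩ := hperiod lamA₀ hlamA₀
  refine ⟨32 * G ^ 2 * |κ₃| + 144 * C ^ 2 / κ₁ * (Q ^ 4 / lamA₀ ^ 2), by positivity, ?_⟩
  intro d _ A hA hlamA Ca hCa1 hCa2 ℓ₀ hℓ₀ est hest resp hresp T
  have hCa : 0 < Ca := (by positivity : 0 < κ₁ * ((d : ℝ) + 1)).trans_le hCa1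
  have hp := hper d A hA hlamA Ca hCa ℓ₀ hℓ₀ est hest resp hresp
  refine ⟨fun θ₀ hθ₀ P hP => ?_, ?_⟩
  · exact integrable_finsetSum _ fun t _ => (hp θ₀ hθ₀ P hP t).1
  · refine iSup₂_le fun θ₀ hθ₀ => iSup₂_le fun P hP => ?_
    rw [EReal.coe_le_coe_iff]
    have hint : ∫ ω, StrategicPricing.realizedRegret ν A Ca ℓ₀ est resp θ₀ T ω
        ∂(StrategicPricing.sampleLaw ν B P) = _ :=
      integral_finsetSum _ fun t _ => (hp θ₀ hθ₀ P hP t).1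
    rw [hint]
    refine (Finset.sum_le_sum fun t _ => (hp θ₀ hθ₀ P hP t).2).trans ?_
    refine (StrategicPricing.sum_period_bound_le hCa hG.le (by positivity) hℓ₀ T).trans ?_
    exact StrategicPricing.regret_constant_bound hG hC hWx hQ hκ₁ hlamA₀ hlamA
      (by linarith [Nat.cast_nonneg (α := ℝ) d]) (Nat.cast_nonneg T) hCa1 hCa2
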